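/- **Setting.** Let $\mathcal S,\mathcal A$ be measurable spaces and $p(\cdot\mid s,a)$ a Markov transition kernel from $\mathcal S\times\mathcal A$ to $\mathcal S$. Let $\mathcal H_S,\mathcal H_A$ be real reproducing kernel Hilbert spaces of functions on $\mathcal S$, $\mathcal A$, with kernels $K_S(s,s')=\phi(s)^\top\phi(s')$ and $K_A(a,a')=\psi(a)^\top\psi(a')$ given by measurable features $\phi=(\phi_1,\dots,\phi_{d_S})$, $\phi_i\in\mathcal H_S$, and $\psi=(\psi_1,\dots,\psi_{d_A})$, $\psi_j\in\mathcal H_A$. For a tensor $X\in\mathbb R^{p_1\times p_2\times p_3}$ let $\|X\|_\sigma=\sup\sum_{i,j,k}X_{ijk}u_iv_jw_k$ over Euclidean unit vectors $u,v,w$; for a square matrix $\|\cdot\|_\sigma$ is the operator norm. $\text{Tucker-Rank}(X)\le(r,l,m)$ means that the three matricizations of $X$ have ranks at most $r$, $l$, $m$. Write $(X\times_1U)_{i'jk}=\sum_iX_{ijk}U_{i'i}$, and similarly for $\times_2$. **Low rank.** The operator $(\mathbb Pf)(s,a)=\int f(s')\,p(ds'\mid s,a)$ maps $\mathcal H_S$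 into $\mathcal H_S\otimes\mathcal H_A$ and has Tucker rank at most $(r,l,m)$: there are $c_{ijk}\in\mathbb R$, $u_i,w_k\in\mathcal H_S$, $v_j\in\mathcal H_A$ ($i\le r$, $j\le l$, $k\le m$) with $(\mathbb Pf)(s,a)=\sum_{i,j,k}c_{ijk}u_i(s)v_j(a)\langle f,w_k\rangle_{\mathcal H_S}$ for all $f\in\mathcal H_S$ and all $s,a$. **Data.** $s_1,a_1,s_2,\dots,a_n,s_{n+1}$ is a single trajectory (with arbitrary initial distribution) under a known behavior policy with density $\bar\pi(a\mid s)$, and $s_i'=s_{i+1}$. $\xi$ is a stationary state distribution under $\bar\pi$. $\eta$ is a probability measure on $\mathcal A$ whose density with respect to the same reference measure is also written $\eta(a)$. The features $\psi$ are orthonormal in $L^2(\eta)$. **Parameters.** For a policy $\pi$ let $p^{t,\pi}(\cdot\mid s_0)$ be the $t$-step law of the induced chain on $\mathcal S$ and $\nu^\pi$ its invariant distribution, and let $$t_{mix}=\sup_\pi\min\{t\ge1:\ \|p^{t',\pi}(\cdot\mid s_0)-\nu^\pi\|_{TV}\le 1/4\ \ \forall s_0\in\mathcal S,\ t'\ge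 t\},$$ where $\|\cdot\|_{TV}$ is the supremum over events. Let $\bm\Sigma=\int\phi\phi^\top d\xi$, $K_{max}=\max\{\sup_sK_S(s,s),\sup_aK_A(a,a)\}$, $\bar\mu=\|\mathbb E_{S\sim\xi}[K_S(S,S)\phi(S)\phi(S)^\top]\|_\sigma$, $\kappa=\sup_{s,a}\eta(a)/\bar\pi(a\mid s)$, and $$\bar\lambda=\sup_{\|u\|=\|v\|=\|w\|=1}\mathbb E\big[\big((u^\top\phi(S))(v^\top\psi(A))(w^\top\phi(S'))\big)^2\big],\qquad (S,A)\sim\xi\otimes\eta,\ S'\sim p(\cdot\mid S,A).$$ Assume that $t_{mix},\kappa,K_{max}<\infty$, that $\bm\Sigma$ is invertible, and that $\bar\lambda>0$. **Estimators.** Let $\hat{\bm\Sigma}=\frac1n\sum_{i=1}^n\phi(s_i)\phi(s_i)^\top$ and $$\bar{\bm F}=\frac1n\sum_{i=1}^n\frac{\eta(a_i)}{\bar\pi(a_i\mid s_i)}\,\phi(s_i)\circ\psi(a_i)\circ\phi(s_i').$$ Let $\hat{\bm F}$ be any minimizer of $\|\bm Q-\bar{\bm F}\|_\sigma$ over $\bm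 Q\in\mathbb R^{d_S\times d_A\times d_S}$ with $\text{Tucker-Rank}(\bm Q)\le(r,l,m)$, and let $\hat{\bm P}=\hat{\bm F}\times_1\hat{\bm\Sigma}^{-1}$. **Theorem.** There is a unique tensor $\bm P\in\mathbb R^{d_S\times d_A\times d_S}$ with $\bm P\times_1\phi(s)^\top\times_2\psi(a)^\top=\mathbb E[\phi(s')\mid s,a]$ for all $s,a$, and $\text{Tucker-Rank}(\bm P)\le(r,l,m)$. Let $\delta\in(0,1)$, and suppose that $n\ge2t_{mix}$ and $$\frac{n/t_{mix}}{(\log(n/t_{mix}))^2}\ \ge\ 1024\Big(\|\bm\Sigma^{-1}\|_\sigma^2\,\bar\mu+\frac{K_{max}^2}{\bar\mu}+\frac{\kappa K_{max}^3}{\bar\lambda}\Big)\Big(\log\frac{2t_{mix}}{\delta}+8(d_S+d_A)\Big).$$ Then with probability at least $1-\delta$, $\hat{\bm\Sigma}$ is invertible and, for every choice of the minimizer $\hat{\bm F}$, $$\|\hat{\bm P}-\bm P\|_\sigma\ \le\ 256\,\|\bm\Sigma^{-1}\|_\sigma\sqrt{\frac{\bar\lambda\big(\log\frac{2t_{mix}}{\delta}+d_S+d_A\big)\big(\kappa+\bar\mu\|\bm\Sigma^{-1}\|_\sigma^2\big)(\log(n/t_{mix}))^2}{n/t_{mix}}}.$$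 -/

import Mathlib

open MeasureTheory ProbabilityTheory
open scoped NNReal ENNReal BigOperators ProbabilityTheory

namespace TensorMDP

noncomputable section

/-! ### Order-three tensors -/

/-- Real tensors of size `p × q × t`. -/
abbrev Tensor3 (p q t : ℕ) : Type := Fin p → Fin q → Fin t → ℝ

/-- The inner product of `X` with the rank-one tensor `u ∘ v ∘ w`. -/
def trilin {p q t : ℕ} (X : Tensor3 p q t) (u : EuclideanSpace ℝ (Fin p))
    (v : EuclideanSpace ℝ (Fin q)) (w : EuclideanSpace ℝ (Fin t)) : ℝ :=
  ∑ i, ∑ j, ∑ k, X i j k * (u i * v j * w k)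

/-- The tensor spectral norm `‖X‖_σ = sup ⟨X, u ∘ v ∘ w⟩` over Euclidean unit vectors. -/
def tensorNorm {p q t : ℕ} (X : Tensor3 p q t) : ℝ :=
  sSup {x : ℝ | ∃ (u : EuclideanSpace ℝ (Fin p)) (v : EuclideanSpace ℝ (Fin q))
    (w : EuclideanSpace ℝ (Fin t)), ‖u‖ = 1 ∧ ‖v‖ = 1 ∧ ‖w‖ = 1 ∧ x = trilin X u v w}

/-- The three matricizations (flattenings) of a tensor. -/
def flatten1 {p q t : ℕ} (X : Tensor3 p q t) : Matrix (Fin p) (Fin q × Fin t) ℝ :=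
  Matrix.of fun i jk => X i jk.1 jk.2

def flatten2 {p q t : ℕ} (X : Tensor3 p q t) : Matrix (Fin q) (Fin p × Fin t) ℝ :=
  Matrix.of fun j ik => X ik.1 j ik.2

def flatten3 {p q t : ℕ} (X : Tensor3 p q t) : Matrix (Fin t) (Fin p × Fin q) ℝ :=
  Matrix.of fun k ij => X ij.1 ij.2 k

/-- `Tucker-Rank(X) ≤ (r, l, m)`. -/
def TuckerRankLE {p q t : ℕ} (X : Tensor3 p q t) (r l m : ℕ) : Prop :=
  (flatten1 X).rank ≤ r ∧ (flatten2 X).rank ≤ l ∧ (flatten3 X).rank ≤ m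

/-- The mode-one product `X ×₁ U`. -/
def modeOne {p p' q t : ℕ} (X : Tensor3 p q t) (U : Matrix (Fin p') (Fin p) ℝ) :
    Tensor3 p' q t :=
  fun i' j k => ∑ i, X i j k * U i' i

/-- `Q` is a best approximation of `X`, in spectral norm, among the tensors of Tucker rank
at most `(r, l, m)`. -/
def IsBestTuckerApprox {p q t : ℕ} (r l m : ℕ) (X Q : Tensor3 p q t) : Prop :=
  TuckerRankLE Q r l m ∧
    ∀ Q' : Tensor3 p q t, TuckerRankLE Q' r l m → tensorNorm (Q - X) ≤ tensorNorm (Q' - X)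

/-- The spectral (Euclidean operator) norm of a square matrix. -/
def matNorm {d : ℕ} (M : Matrix (Fin d) (Fin d) ℝ) : ℝ :=
  ‖Matrix.toEuclideanCLM (𝕜 := ℝ) M‖

/-! ### Markov decision processes: policies and mixing -/

section MDP

variable {S A : Type*} [MeasurableSpace S] [MeasurableSpace A]

/-- The Markov chain on states induced by a policy:
`p^π(B | s) = ∫ p(B | s, a) π(da | s)`. -/
def stateKernel (p : Kernel (S × A) S) (π : Kernel S A) : Kernel S S :=
  p ∘ₖ (Kernel.id ×ₖ π)

/-- Total variation distance `sup_B |μ(B) - ν(B)|`. -/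
def tvDist (μ ν : Measure S) : ℝ :=
  ⨆ B : {B : Set S // MeasurableSet B}, |μ.real B.1 - ν.real B.1|

/-- From every starting state the chain is within `1/4` of its invariant distribution at all
times from `t` on. -/
def MixesBy (q : Kernel S S) (t : ℕ) : Prop :=
  ∃ ν : Measure S, IsProbabilityMeasure ν ∧ Kernel.Invariant q ν ∧
    ∀ t' ≥ t, ∀ s₀ : S, tvDist ((q ^ t') s₀) ν ≤ 1 / 4

/-- The mixing time of a chain: the least number `t ≥ 1` of steps after which it has mixed
(`⊤` if there is none). -/
def mixingTime (q : Kernel S S) : ℕ∞ :=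
  ⨅ t : {t : ℕ // 1 ≤ t ∧ MixesBy q t}, ((t : ℕ) : ℕ∞)

/-- The worst-case mixing time of the decision process, over all policies. -/
def worstMixingTime (p : Kernel (S × A) S) : ℕ∞ :=
  ⨆ π : {π : Kernel S A // IsMarkovKernel π}, mixingTime (stateKernel p π.1)

/-! ### Data from a single trajectory -/

/-- The `σ`-algebra of `s_0, a_0, …, s_{i-1}, a_{i-1}, s_i`. -/
@[reducible] def historyState {Ω : Type*} {n : ℕ} (s : Fin (n + 1) → Ω → S) (a : Fin n → Ω → A)
    (i : Fin n) : MeasurableSpace Ω :=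
  (⨆ j : {j : Fin n // j < i},
      (MeasurableSpace.comap (s j.1.castSucc) inferInstance ⊔
        MeasurableSpace.comap (a j.1) inferInstance)) ⊔
    MeasurableSpace.comap (s i.castSucc) inferInstance

/-- The `σ`-algebra of `s_0, a_0, …, s_i, a_i`. -/
@[reducible] def historyAction {Ω : Type*} {n : ℕ} (s : Fin (n + 1) → Ω → S) (a : Fin n → Ω → A)
    (i : Fin n) : MeasurableSpace Ω :=
  historyState s a i ⊔ MeasurableSpace.comap (a i) inferInstance

/-- `s_0, a_0, s_1, …, a_{n-1}, s_n` is a sample path of the decision process with transition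
kernel `p` under the policy `π`, started from an arbitrary initial distribution: given the past,
`a_i` has law `π(· | s_i)` and `s_{i+1}` has law `p(· | s_i, a_i)`. -/
structure IsTrajectory {Ω : Type*} [MeasurableSpace Ω] (μ : Measure Ω)
    (p : Kernel (S × A) S) (π : Kernel S A) {n : ℕ}
    (s : Fin (n + 1) → Ω → S) (a : Fin n → Ω → A) : Prop where
  measurable_state : ∀ i, Measurable (s i)
  measurable_action : ∀ i, Measurable (a i)
  action_law : ∀ (i : Fin n) (C : Set A), MeasurableSet C →
    μ[(a i ⁻¹' C).indicator (fun _ => (1 : ℝ)) | historyState s a i]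
      =ᵐ[μ] fun ω => (π (s i.castSucc ω)).real C
  state_law : ∀ (i : Fin n) (B : Set S), MeasurableSet B →
    μ[(s i.succ ⁻¹' B).indicator (fun _ => (1 : ℝ)) | historyAction s a i]
      =ᵐ[μ] fun ω => (p (s i.castSucc ω, a i ω)).real B

end MDP

/-! ### Kernels, features, and the low-rank assumption -/

/-- The scalar reproducing kernel `K(x, y)` of a reproducing kernel Hilbert space. -/
def scalarKernel {X : Type*} (H : Type*) [NormedAddCommGroup H] [InnerProductSpace ℝ H]
    [CompleteSpace H] [RKHS ℝ H X ℝ] (x y : X) : ℝ :=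
  RKHS.kernel H x y 1

/-- `φ_1, …, φ_d` are features of the space `H`: `K(x, y) = ∑ i, φ_i(x) φ_i(y)`. -/
def IsFeatureMap {X H : Type*} [NormedAddCommGroup H] [InnerProductSpace ℝ H]
    [CompleteSpace H] [RKHS ℝ H X ℝ] {d : ℕ} (φ : Fin d → H) : Prop :=
  ∀ x y : X, scalarKernel H x y = ∑ i, φ i x * φ i y

section Features

variable {S A : Type*} [MeasurableSpace S] [MeasurableSpace A]
  {HS : Type*} [NormedAddCommGroup HS] [InnerProductSpace ℝ HS] [RKHS ℝ HS S ℝ]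
  {HA : Type*} [NormedAddCommGroup HA] [InnerProductSpace ℝ HA] [RKHS ℝ HA A ℝ]

/-- The transition operator `(ℙ f)(s, a) = ∫ f(s') p(ds' | s, a)`. -/
def transitionOp (p : Kernel (S × A) S) (f : S → ℝ) (s : S) (a : A) : ℝ :=
  ∫ s', f s' ∂(p (s, a))

/-- The transition operator has Tucker rank at most `(r, l, m)` (a representation with fewer
terms can be padded with zeros), and it maps `HS` into the tensor product of `HS` and `HA`. -/
structure LowRankTransition (HS HA : Type*)
    [NormedAddCommGroup HS] [InnerProductSpace ℝ HS] [RKHS ℝ HS S ℝ]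
    [NormedAddCommGroup HA] [InnerProductSpace ℝ HA] [RKHS ℝ HA A ℝ]
    (p : Kernel (S × A) S) (r l m : ℕ) : Prop where
  tucker : ∃ (c : Tensor3 r l m) (u : Fin r → HS) (v : Fin l → HA) (w : Fin m → HS),
    ∀ (f : HS) (s : S) (a : A), transitionOp p f s a =
      ∑ i, ∑ j, ∑ k, c i j k * u i s * v j a * inner ℝ f (w k)
  mem_tensor : ∀ f : HS, ∃ (N : ℕ) (g : Fin N → HS) (h : Fin N → HA),
    ∀ (s : S) (a : A), transitionOp p f s a = ∑ i, g i s * h i a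

/-- `X` is a transition tensor: `X ×₁ φ(s)ᵀ ×₂ ψ(a)ᵀ = 𝔼[φ(s') | s, a]` for all `s`, `a`. -/
def IsTransitionTensor (p : Kernel (S × A) S) {dS dA : ℕ} (φ : Fin dS → HS) (ψ : Fin dA → HA)
    (X : Tensor3 dS dA dS) : Prop :=
  ∀ (s : S) (a : A) (k : Fin dS),
    ∑ i, ∑ j, X i j k * φ i s * ψ j a = transitionOp p (φ k) s a

/-- `ψ_1, …, ψ_d` is orthonormal in `L²(η)`. -/
def OrthonormalL2 {dA : ℕ} (ψ : Fin dA → HA) (η : Measure A) : Prop :=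
  ∀ i j, ∫ a, ψ i a * ψ j a ∂η = if i = j then 1 else 0

/-! ### Parameters of the problem -/

/-- `Σ = ∫ φ(s) φ(s)ᵀ ξ(ds)`. -/
def covMatrix {dS : ℕ} (φ : Fin dS → HS) (ξ : Measure S) : Matrix (Fin dS) (Fin dS) ℝ :=
  Matrix.of fun i j => ∫ s, φ i s * φ j s ∂ξ

/-- `K_max = max {sup_s K_S(s, s), sup_a K_A(a, a)}`. -/
def kMax (S A HS HA : Type*)
    [NormedAddCommGroup HS] [InnerProductSpace ℝ HS] [CompleteSpace HS] [RKHS ℝ HS S ℝ]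
    [NormedAddCommGroup HA] [InnerProductSpace ℝ HA] [CompleteSpace HA] [RKHS ℝ HA A ℝ] : ℝ :=
  max (⨆ s : S, scalarKernel HS s s) (⨆ a : A, scalarKernel HA a a)

/-- `μ̄ = ‖𝔼[K_S(s, s) φ(s) φ(s)ᵀ]‖` for `s` of law `ξ`. -/
def muBar [CompleteSpace HS] {dS : ℕ} (φ : Fin dS → HS) (ξ : Measure S) : ℝ :=
  matNorm (Matrix.of fun i j => ∫ s, scalarKernel HS s s * (φ i s * φ j s) ∂ξ)

/-- `κ = sup_{s, a} η(a) / π(a | s)`, for densities `η` and `π` with respect to the same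
measure. -/
def kappa (eta : A → ℝ≥0) (dens : S → A → ℝ≥0) : ℝ≥0∞ :=
  ⨆ (s : S) (a : A), (eta a : ℝ≥0∞) / (dens s a : ℝ≥0∞)

/-- `λ̄`: the supremum over unit vectors of `𝔼[((uᵀφ(s)) (vᵀψ(a)) (wᵀφ(s')))²]`, where `s` has
law `ξ`, independently `a` has law `η`, and `s'` has law `p(· | s, a)`. -/
def lambdaBar (p : Kernel (S × A) S) {dS dA : ℕ} (φ : Fin dS → HS) (ψ : Fin dA → HA)
    (ξ : Measure S) (η : Measure A) : ℝ :=
  sSup {x : ℝ | ∃ (u : EuclideanSpace ℝ (Fin dS)) (v : EuclideanSpace ℝ (Fin dA))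
    (w : EuclideanSpace ℝ (Fin dS)), ‖u‖ = 1 ∧ ‖v‖ = 1 ∧ ‖w‖ = 1 ∧
    x = ∫ z : (S × A) × S,
      ((∑ i, u i * φ i z.1.1) * (∑ j, v j * ψ j z.1.2) * (∑ k, w k * φ k z.2)) ^ 2
        ∂((ξ.prod η) ⊗ₘ p)}

/-! ### Estimators -/

/-- The importance-weighted empirical mean embedding
`F̄ = n⁻¹ ∑ᵢ (η(aᵢ) / π̄(aᵢ | sᵢ)) φ(sᵢ) ∘ ψ(aᵢ) ∘ φ(sᵢ₊₁)`. -/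
def meanEmbedding {dS dA n : ℕ} (φ : Fin dS → HS) (ψ : Fin dA → HA) (eta : A → ℝ≥0)
    (dens : S → A → ℝ≥0) (s : Fin (n + 1) → S) (a : Fin n → A) : Tensor3 dS dA dS :=
  fun i j k => (n : ℝ)⁻¹ * ∑ x : Fin n,
    ((eta (a x) : ℝ) / (dens (s x.castSucc) (a x) : ℝ)) *
      (φ i (s x.castSucc) * ψ j (a x) * φ k (s x.succ))

/-- The empirical covariance `Σ̂ = n⁻¹ ∑ᵢ φ(sᵢ) φ(sᵢ)ᵀ`. -/
def empCov {dS n : ℕ} (φ : Fin dS → HS) (s : Fin (n + 1) → S) : Matrix (Fin dS) (Fin dS) ℝ :=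
  Matrix.of fun i j => (n : ℝ)⁻¹ * ∑ x : Fin n, φ i (s x.castSucc) * φ j (s x.castSucc)

end Features

end

end TensorMDP

open TensorMDP

/-! Let `F` be the mean of φ(s) ∘ ψ(a) ∘ φ(s') under `(ξ.prod η) ⊗ₘ p`. Integrating out s' and using
the orthonormality of ψ in L²(η) gives F = P ×₁ Σ, hence P = F ×₁ Σ⁻¹. The importance weights turn
stationary means under the behavior policy into means under η, so each summand of F̄ has stationary
mean F. The tensor P exists because the features span the kernel spaces, so the Tucker factors of
the transition operator can be expanded in them.

Deterministic part: F inherits the Tucker rank bound of P, so it competes with F̂ and ‖F̂ − F‖ ≤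
2‖F̄ − F‖. The error is (F̂ − F) ×₁ Σ̂⁻¹ − F ×₁ (Σ⁻¹ − Σ̂⁻¹), where ‖F‖ ≤ √λ̄ by Jensen and the
inverses are compared by perturbation theory (`tensorNorm_plugin_sub_le`).

Probabilistic part: tested on fixed unit vectors, F̄ and Σ̂ are empirical means of bounded functions
along one dependent path. With T the mixing time, T steps of the chain halve the oscillation of
every bounded function (`HasOscLE.kernel_integral_half`), so after T·M steps the initial state is
forgotten up to a factor 2⁻ᴹ. The path is split into ℓ = T(M + 1) interlaced subsequences of spacing
ℓ. Along each one exponential moments multiply almost as under independence, and convexity of exp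
averages over the subsequences. Markov's inequality then yields a Bernstein bound with effective
sample size n/ℓ (`measure_le_sum_transition_le`). Taking M ≈ 2 log(n/T) makes the bias negligible;
one logarithm in the rate pays for this, the other absorbs constants.

Nets of at most 5ᵈ points on the spheres make the bounds uniform, at the cost of factors 4 and 8 and
of the dimension term. The second moments are at most μ̄ and κλ̄ and the sup bounds are K and
κK^{3/2}, so the ratios b²/v are the last two terms of the sample size condition. The first term,
‖Σ⁻¹‖²μ̄, keeps the perturbation of Σ within the range where inversion is stable. -/

/-! ### Contraction of oscillations by a mixing chain -/

section Mixing

variable {S : Type*} [MeasurableSpace S]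

/-- A bounded measurable function is integrable for every finite measure. -/
lemma integrable_of_abs_le {X : Type*} [MeasurableSpace X] {μ : Measure X} [IsFiniteMeasure μ]
    {f : X → ℝ} (hf : Measurable f) {C : ℝ} (hC : ∀ x, |f x| ≤ C) : Integrable f μ :=
  Integrable.of_bound hf.aestronglyMeasurable C (ae_of_all _ hC)

lemma integral_bind_kernel {X Y : Type*} [MeasurableSpace X] [MeasurableSpace Y] (μ : Measure X)
    [IsFiniteMeasure μ] (κ : Kernel X Y) [IsMarkovKernel κ] {f : Y → ℝ} (hf : Measurable f) {C : ℝ}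
    (hC : ∀ y, |f y| ≤ C) : ∫ y, f y ∂(μ.bind κ) = ∫ x, ∫ y, f y ∂(κ x) ∂μ := by
  have h := Kernel.integral_comp (η := κ) (κ := Kernel.const Unit μ) (a := ()) (f := f)
    (integrable_of_abs_le hf hC)
  rwa [Kernel.comp_const, Kernel.const_apply, Kernel.const_apply] at h

lemma abs_measureReal_sub_le_tvDist (μ ν : Measure S) [IsProbabilityMeasure μ]
    [IsProbabilityMeasure ν] {B : Set S} (hB : MeasurableSet B) :
    |μ.real B - ν.real B| ≤ tvDist μ ν := by
  refine le_ciSup (f := fun B : {B : Set S // MeasurableSet B} => |μ.real B.1 - ν.real B.1|)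
    ⟨1, ?_⟩ ⟨B, hB⟩
  rintro _ ⟨C, rfl⟩
  have h1 := measureReal_le_one (μ := μ) (s := C.1)
  have h2 := measureReal_le_one (μ := ν) (s := C.1)
  have h3 : 0 ≤ μ.real C.1 := measureReal_nonneg
  have h4 : 0 ≤ ν.real C.1 := measureReal_nonneg
  exact abs_le.2 ⟨by linarith, by linarith⟩

/-- Layer-cake formula: the integral is that of the tail probabilities over the levels in (0, D],
and at each level the two tails differ by at most the total variation distance. -/
lemma integral_sub_le_mul_tvDist (μ ν : Measure S) [IsProbabilityMeasure μ]
    [IsProbabilityMeasure ν] {f : S → ℝ} (hf : Measurable f) {D : ℝ} (hD : 0 ≤ D)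
    (h0 : ∀ x, 0 ≤ f x) (h1 : ∀ x, f x ≤ D) :
    |∫ x, f x ∂μ - ∫ x, f x ∂ν| ≤ D * tvDist μ ν := by
  have habs : ∀ x, |f x| ≤ D := fun x => by rw [abs_of_nonneg (h0 x)]; exact h1 x
  have key : ∀ (ρ : Measure S) [IsProbabilityMeasure ρ],
      ∫ x, f x ∂ρ = ∫ t in Set.Ioc 0 D, ρ.real {x | t < f x} := by
    intro ρ _
    rw [(integrable_of_abs_le hf habs).integral_eq_integral_meas_lt (ae_of_all _ h0)]
    refine (setIntegral_eq_of_subset_of_forall_sdiff_eq_zero measurableSet_Ioi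
      Set.Ioc_subset_Ioi_self ?_)
    rintro t ⟨ht, ht'⟩
    have : {x | t < f x} = ∅ := by
      ext x
      simp only [Set.mem_ofPred_eq, Set.mem_empty_iff_false, iff_false, not_lt]
      by_contra hlt
      exact ht' ⟨ht, (not_le.1 hlt).le.trans (h1 x)⟩
    simp [this]
  have hmeas : ∀ (ρ : Measure S) [IsProbabilityMeasure ρ],
      IntegrableOn (fun t => ρ.real {x | t < f x}) (Set.Ioc 0 D) := by
    intro ρ _
    have hanti : Antitone fun t => ρ.real {x | t < f x} := fun a b hab =>
      measureReal_mono fun x hx => lt_of_le_of_lt hab hx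
    exact integrable_of_abs_le hanti.measurable (C := 1) fun t => by
      rw [abs_of_nonneg measureReal_nonneg]; exact measureReal_le_one
  rw [key μ, key ν, ← integral_sub (hmeas μ) (hmeas ν)]
  have := norm_setIntegral_le_of_norm_le_const (μ := volume) (s := Set.Ioc 0 D)
    (f := fun t => μ.real {x | t < f x} - ν.real {x | t < f x}) (C := tvDist μ ν)
    (by simp) fun t _ =>
      abs_measureReal_sub_le_tvDist μ ν (hf measurableSet_Ioi)
  rw [Real.norm_eq_abs] at this
  refine this.trans ?_
  simp [Measure.real, hD, mul_comm]

/-- A bounded measurable function whose oscillation is at most `D`. -/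
structure HasOscLE (f : S → ℝ) (D : ℝ) : Prop where
  measurable : Measurable f
  bounded : ∃ C, ∀ x, |f x| ≤ C
  sub_le : ∀ x y, f x - f y ≤ D

lemma HasOscLE.integrable {f : S → ℝ} {D : ℝ} (h : HasOscLE f D) (μ : Measure S)
    [IsFiniteMeasure μ] : Integrable f μ :=
  integrable_of_abs_le h.measurable h.bounded.choose_spec

/-- Subtracting the infimum of `f` leaves the difference of integrals unchanged and gives a function
with values in [0, D]. -/
lemma HasOscLE.integral_sub_le {f : S → ℝ} {D : ℝ} (h : HasOscLE f D) (μ ν : Measure S)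
    [IsProbabilityMeasure μ] [IsProbabilityMeasure ν] :
    |∫ x, f x ∂μ - ∫ x, f x ∂ν| ≤ D * tvDist μ ν := by
  obtain ⟨C, hC⟩ := h.bounded
  have hne : Nonempty S := nonempty_of_isProbabilityMeasure μ
  have hbdd : BddBelow (Set.range f) := ⟨-C, by rintro _ ⟨x, rfl⟩; exact (abs_le.1 (hC x)).1⟩
  have hle : ∀ x, f x - (⨅ y, f y) ≤ D := fun x => by
    have : f x - D ≤ ⨅ y, f y := le_ciInf fun y => by linarith [h.sub_le x y]
    linarith
  have h0 : ∀ x, 0 ≤ f x - (⨅ y, f y) := fun x => by linarith [ciInf_le hbdd x]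
  have hD : 0 ≤ D := (h0 hne.some).trans (hle _)
  have := integral_sub_le_mul_tvDist μ ν (h.measurable.sub_const (⨅ y, f y)) hD h0 hle
  rw [integral_sub (h.integrable μ) (integrable_const _),
    integral_sub (h.integrable ν) (integrable_const _)] at this
  simpa using this

lemma HasOscLE.kernel_integral {f : S → ℝ} {D : ℝ} (h : HasOscLE f D) (q : Kernel S S)
    [IsMarkovKernel q] : HasOscLE (fun x => ∫ y, f y ∂(q x)) D := by
  obtain ⟨C, hC⟩ := h.bounded
  refine ⟨(h.measurable.stronglyMeasurable.integral_kernel (κ := q)).measurable,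
    ⟨C, fun x => ?_⟩, fun x y => ?_⟩
  · have := norm_integral_le_of_norm_le_const (μ := q x) (f := f) (C := C) (ae_of_all _ hC)
    simpa using this
  · have h1 : ∀ z, ∫ w, f w ∂(q x) ≤ D + f z := fun z => by
      have := integral_mono (h.integrable (q x)) (integrable_const (D + f z))
        fun w => by have := h.sub_le w z; show f w ≤ D + f z; linarith
      simpa using this
    have h2 := integral_mono (integrable_const (∫ w, f w ∂(q x) - D)) (h.integrable (q y))
      fun z => by have := h1 z; show ∫ w, f w ∂(q x) - D ≤ f z; linarith
    simp only [integral_const, probReal_univ, smul_eq_mul, one_mul] at h2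
    linarith

/-- From any two starting points the integrals lie within D/4 of the integral against `ν`, hence
within D/2 of each other. -/
lemma HasOscLE.kernel_integral_half {f : S → ℝ} {D : ℝ} (h : HasOscLE f D) (q : Kernel S S)
    [IsMarkovKernel q] (ν : Measure S) [IsProbabilityMeasure ν]
    (hν : ∀ x, tvDist (q x) ν ≤ 1 / 4) :
    HasOscLE (fun x => ∫ y, f y ∂(q x)) (D / 2) := by
  refine ⟨(h.kernel_integral q).measurable, (h.kernel_integral q).bounded, fun x y => ?_⟩
  have hD : 0 ≤ D := by simpa using h.sub_le x x
  have hx := (abs_le.1 (h.integral_sub_le (q x) ν)).2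
  have hy := (abs_le.1 (h.integral_sub_le (q y) ν)).1
  have := mul_le_mul_of_nonneg_left (hν x) hD
  have := mul_le_mul_of_nonneg_left (hν y) hD
  linarith

instance instIsMarkovKernelPow (q : Kernel S S) [IsMarkovKernel q] (k : ℕ) :
    IsMarkovKernel (q ^ k) := by
  induction k with
  | zero => rw [pow_zero]; exact inferInstanceAs (IsMarkovKernel (Kernel.id : Kernel S S))
  | succ k ih => rw [pow_succ]; exact inferInstanceAs (IsMarkovKernel ((q ^ k) ∘ₖ q))

lemma HasOscLE.integral_pow_add {f : S → ℝ} {D : ℝ} (h : HasOscLE f D) (q : Kernel S S)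
    [IsMarkovKernel q] (j k : ℕ) (x : S) :
    ∫ z, f z ∂((q ^ (j + k)) x) = ∫ y, ∫ z, f z ∂((q ^ j) y) ∂((q ^ k) x) := by
  rw [Kernel.pow_add]
  exact Kernel.integral_comp (h.integrable _)

/-- Each block of `T` steps halves the oscillation; the `k` additional steps only average and cannot
increase it. -/
lemma HasOscLE.integral_pow {f : S → ℝ} {D : ℝ} (h : HasOscLE f D) (q : Kernel S S)
    [IsMarkovKernel q] {T : ℕ} (hT : MixesBy q T) (M k : ℕ) :
    HasOscLE (fun x => ∫ y, f y ∂((q ^ (k + T * M)) x)) (D / 2 ^ M) := by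
  obtain ⟨ν, hν, -, hmix⟩ := hT
  induction M with
  | zero => simpa using h.kernel_integral (q ^ k)
  | succ M ih =>
    have := ih.kernel_integral_half (q ^ T) ν (hmix T le_rfl)
    rw [show k + T * (M + 1) = (k + T * M) + T by ring, pow_succ, ← div_div]
    simpa only [h.integral_pow_add] using this

lemma invariant_pow {q : Kernel S S} {ξ : Measure S} (h : Kernel.Invariant q ξ) (k : ℕ) :
    Kernel.Invariant (q ^ k) ξ := by
  induction k with
  | zero => rw [pow_zero]; exact Measure.bind_dirac (m := ξ)
  | succ k ih => rw [pow_succ]; exact ih.comp h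

/-- Geometric ergodicity of a mixing chain, tested on functions of bounded oscillation. -/
lemma HasOscLE.integral_pow_le {f : S → ℝ} {D : ℝ} (h : HasOscLE f D) (q : Kernel S S)
    [IsMarkovKernel q] {T : ℕ} (hT : MixesBy q T) (ξ : Measure S) [IsProbabilityMeasure ξ]
    (hξ : Kernel.Invariant q ξ) (M k : ℕ) (hk : T * M ≤ k) (x : S) :
    ∫ y, f y ∂((q ^ k) x) ≤ ∫ y, f y ∂ξ + D / 2 ^ M := by
  obtain ⟨j, rfl⟩ := Nat.exists_eq_add_of_le' hk
  have hosc := h.integral_pow q hT M j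
  -- By invariance the stationary mean is itself a `ξ`-average of the values at time `j + T * M`,
  -- and these differ from one another by at most D / 2ᴹ.
  have hinv : ∫ y, f y ∂ξ = ∫ x, ∫ y, f y ∂((q ^ (j + T * M)) x) ∂ξ := by
    conv_lhs => rw [← (invariant_pow hξ (j + T * M)).def]
    exact integral_bind_kernel ξ _ h.measurable h.bounded.choose_spec
  rw [hinv]
  have := integral_mono (μ := ξ)
    (integrable_const (∫ y, f y ∂((q ^ (j + T * M)) x) - D / 2 ^ M)) (hosc.integrable ξ)
    fun z => by
      have := hosc.sub_le x z
      show ∫ y, f y ∂((q ^ (j + T * M)) x) - D / 2 ^ M ≤ ∫ y, f y ∂((q ^ (j + T * M)) z)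
      linarith
  simp only [integral_const, probReal_univ, smul_eq_mul, one_mul] at this
  linarith

lemma mixesBy_of_worstMixingTime {A : Type*} [MeasurableSpace A] (p : Kernel (S × A) S)
    (ht : worstMixingTime p ≠ ⊤) (π : Kernel S A) [hπ : IsMarkovKernel π] :
    1 ≤ (worstMixingTime p).toNat ∧ MixesBy (stateKernel p π) (worstMixingTime p).toNat := by
  have hle : mixingTime (stateKernel p π) ≤ worstMixingTime p :=
    le_iSup (fun π : {π : Kernel S A // IsMarkovKernel π} => mixingTime (stateKernel p π.1))
      ⟨π, hπ⟩
  -- Strict inequality against the supremum plus one produces an actual witness of the infimum. Its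
  -- bound holds at all later times, so it can be moved up to the worst-case mixing time.
  have hlt : mixingTime (stateKernel p π) < worstMixingTime p + 1 := by
    refine hle.trans_lt ?_
    exact (ENat.lt_add_one_iff ht).2 le_rfl
  obtain ⟨⟨t₀, h1, hmix⟩, ht₀⟩ := iInf_lt_iff.1 hlt
  have ht₀' : t₀ ≤ (worstMixingTime p).toNat := by
    have : (t₀ : ℕ∞) ≤ worstMixingTime p := (ENat.lt_add_one_iff ht).1 ht₀
    rw [← ENat.natCast_toNat ht] at this
    exact_mod_cast this
  obtain ⟨ν, hν, hinv, hm⟩ := hmix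
  exact ⟨h1.trans ht₀', ν, hν, hinv, fun t' h' => hm t' (ht₀'.trans h')⟩

end Mixing

/-! ### From conditional probabilities to disintegration of joint laws -/

section MarkovProperty

variable {Ω T E : Type*} {m mΩ : MeasurableSpace Ω} [MeasurableSpace T] [MeasurableSpace E]
  {μ : Measure Ω} [IsProbabilityMeasure μ]

/-- Rectangles determine the joint law, and on D × B the identity is the defining property of
conditional expectation over the `m`-measurable event `Y ⁻¹' D`. -/
lemma map_prod_eq_compProd_of_condExp (hm : m ≤ mΩ) {Y : Ω → T}
    (hY : Measurable[m] Y) {X : Ω → E} (hX : Measurable X) (κ : Kernel T E) [IsMarkovKernel κ]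
    (h : ∀ B : Set E, MeasurableSet B → μ[(X ⁻¹' B).indicator (fun _ => (1 : ℝ)) | m]
      =ᵐ[μ] fun ω => (κ (Y ω)).real B) :
    μ.map (fun ω => (Y ω, X ω)) = (μ.map Y) ⊗ₘ κ := by
  have hY' : Measurable Y := hY.mono hm le_rfl
  have : IsProbabilityMeasure (μ.map Y) := Measure.isProbabilityMeasure_map hY'.aemeasurable
  have : IsProbabilityMeasure (μ.map fun ω => (Y ω, X ω)) :=
    Measure.isProbabilityMeasure_map (hY'.prodMk hX).aemeasurable
  refine Measure.ext_prod fun {D B} hD hB => ?_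
  rw [Measure.map_apply (hY'.prodMk hX) (hD.prod hB), Measure.compProd_apply_prod hD hB,
    setLIntegral_map hD (κ.measurable_coe hB) hY']
  have hint : Integrable ((X ⁻¹' B).indicator fun _ => (1 : ℝ)) μ :=
    (integrable_const _).indicator (hX hB)
  have h1 : ∫ ω in Y ⁻¹' D, (X ⁻¹' B).indicator (fun _ => (1 : ℝ)) ω ∂μ
      = ∫ ω in Y ⁻¹' D, (κ (Y ω)).real B ∂μ := by
    rw [← setIntegral_condExp hm hint (hY hD)]
    exact setIntegral_congr_ae (hY' hD) ((h B hB).mono fun _ hω _ => hω)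
  have h2 : μ (Y ⁻¹' D ∩ X ⁻¹' B) =
      ENNReal.ofReal (∫ ω in Y ⁻¹' D, (X ⁻¹' B).indicator (fun _ => (1 : ℝ)) ω ∂μ) := by
    rw [integral_indicator (hX hB), Measure.restrict_restrict (hX hB), Set.inter_comm]
    simp
  have h3 : ENNReal.ofReal (∫ ω in Y ⁻¹' D, (κ (Y ω)).real B ∂μ)
      = ∫⁻ ω in Y ⁻¹' D, κ (Y ω) B ∂μ := by
    rw [ofReal_integral_eq_lintegral_ofReal]
    · simp
    · exact integrable_of_abs_le (C := 1)
        ((κ.measurable_coe hB).comp hY').ennreal_toReal fun ω => by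
          rw [abs_of_nonneg measureReal_nonneg]; exact measureReal_le_one
    · exact ae_of_all _ fun _ => measureReal_nonneg
  rw [← h3, ← h1, ← h2]
  rfl

/-- The weight `W` stands for an arbitrary functional of the past. It is handled by disintegrating
over the pair (Y, W), with a kernel that ignores `W`. -/
lemma lintegral_mul_eq_of_condExp (hm : m ≤ mΩ) {Y : Ω → T}
    (hY : Measurable[m] Y) {X : Ω → E} (hX : Measurable X) (κ : Kernel T E) [IsMarkovKernel κ]
    (h : ∀ B : Set E, MeasurableSet B → μ[(X ⁻¹' B).indicator (fun _ => (1 : ℝ)) | m]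
      =ᵐ[μ] fun ω => (κ (Y ω)).real B)
    {W : Ω → ℝ≥0∞} (hW : Measurable[m] W) {g : T × E → ℝ≥0∞} (hg : Measurable g) :
    ∫⁻ ω, W ω * g (Y ω, X ω) ∂μ = ∫⁻ ω, W ω * ∫⁻ x, g (Y ω, x) ∂(κ (Y ω)) ∂μ := by
  have hY' : Measurable Y := hY.mono hm le_rfl
  have hW' : Measurable W := hW.mono hm le_rfl
  have hlaw := map_prod_eq_compProd_of_condExp (μ := μ) hm (hY.prodMk hW) hX
    (κ.comap Prod.fst measurable_fst) (by simpa [Kernel.comap_apply] using h)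
  have hF : Measurable fun z : (T × ℝ≥0∞) × E => z.1.2 * g (z.1.1, z.2) := by fun_prop
  have h1 : ∫⁻ ω, W ω * g (Y ω, X ω) ∂μ
      = ∫⁻ z, z.1.2 * g (z.1.1, z.2) ∂(μ.map fun ω => ((Y ω, W ω), X ω)) := by
    rw [lintegral_map hF (by fun_prop)]
  rw [h1, hlaw, Measure.lintegral_compProd hF, lintegral_map hF.lintegral_kernel_prod_right'
    (by fun_prop)]
  refine lintegral_congr fun ω => ?_
  simp only [Kernel.comap_apply]
  exact lintegral_const_mul _ (hg.comp measurable_prodMk_left)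

end MarkovProperty

/-! ### Integrating functionals of the trajectory -/

section Trajectory

variable {S A : Type*} [MeasurableSpace S] [MeasurableSpace A]

/-- The law of `((s, a), s')` given `s`, for an action `a` drawn from the policy `π` and a next
state `s'`. -/
noncomputable def stepKernel (p : Kernel (S × A) S) (π : Kernel S A) : Kernel S ((S × A) × S) :=
  (Kernel.id ×ₖ π) ⊗ₖ Kernel.prodMkLeft S p

variable {Ω : Type*} {n : ℕ} {s : Fin (n + 1) → Ω → S} {a : Fin n → Ω → A}

lemma measurable_state_historyState {i : Fin n} {x : Fin (n + 1)} (h : (x : ℕ) ≤ i) :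
    Measurable[historyState s a i] (s x) := by
  rcases h.lt_or_eq with h | h
  · have hx : (x : ℕ) < n := h.trans i.2
    have hle : MeasurableSpace.comap (s x) inferInstance ≤ historyState s a i := by
      refine le_trans ?_ le_sup_left
      refine le_trans ?_ (le_iSup _ (⟨⟨x, hx⟩, h⟩ : {j : Fin n // j < i}))
      exact le_sup_left
    exact (comap_measurable (s x)).mono hle le_rfl
  · obtain rfl : x = i.castSucc := Fin.ext h
    exact (comap_measurable (s i.castSucc)).mono le_sup_right le_rfl

lemma measurable_action_historyState {i x : Fin n} (h : x < i) :
    Measurable[historyState s a i] (a x) := by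
  have hle : MeasurableSpace.comap (a x) inferInstance ≤ historyState s a i := by
    refine le_trans ?_ le_sup_left
    refine le_trans ?_ (le_iSup _ (⟨x, h⟩ : {j : Fin n // j < i}))
    exact le_sup_right
  exact (comap_measurable (a x)).mono hle le_rfl

lemma historyState_mono {i j : Fin n} (h : i ≤ j) : historyState s a i ≤ historyState s a j := by
  refine sup_le (iSup_le fun x => sup_le ?_ ?_) ?_
  · exact (measurable_state_historyState (le_of_lt (lt_of_lt_of_le x.2 h))).comap_le
  · exact (measurable_action_historyState (lt_of_lt_of_le x.2 h)).comap_le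
  · exact (measurable_state_historyState (by simpa using h)).comap_le

variable [mΩ : MeasurableSpace Ω] {μ : Measure Ω} {p : Kernel (S × A) S} {π : Kernel S A}

lemma TensorMDP.IsTrajectory.historyState_le (hd : IsTrajectory μ p π s a) (i : Fin n) : historyState s a i ≤ mΩ :=
  sup_le (iSup_le fun _ => sup_le (hd.measurable_state _).comap_le
    (hd.measurable_action _).comap_le) (hd.measurable_state _).comap_le

lemma TensorMDP.IsTrajectory.historyAction_le (hd : IsTrajectory μ p π s a) (i : Fin n) : historyAction s a i ≤ mΩ :=
  sup_le (hd.historyState_le i) (hd.measurable_action _).comap_le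

variable [IsMarkovKernel p] [IsMarkovKernel π]

instance instIsMarkovKernelStepKernel : IsMarkovKernel (stepKernel p π) := by
  unfold stepKernel; infer_instance

instance instIsMarkovKernelStateKernel : IsMarkovKernel (stateKernel p π) := by
  unfold stateKernel; infer_instance

lemma lintegral_stepKernel (s : S) {g : (S × A) × S → ℝ≥0∞} (hg : Measurable g) :
    ∫⁻ z, g z ∂(stepKernel p π s) = ∫⁻ a, ∫⁻ s', g ((s, a), s') ∂(p (s, a)) ∂(π s) := by
  rw [stepKernel, Kernel.lintegral_compProd _ _ _ hg]
  simp only [Kernel.prodMkLeft_apply]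
  exact Kernel.lintegral_id_prod (f := fun z => ∫⁻ c, g (z, c) ∂(p z))
    hg.lintegral_kernel_prod_right' _ _

lemma lintegral_stateKernel (s : S) {H : S → ℝ≥0∞} (hH : Measurable H) :
    ∫⁻ x, H x ∂(stateKernel p π s) = ∫⁻ z, H z.2 ∂(stepKernel p π s) := by
  rw [lintegral_stepKernel s (g := fun z => H z.2) (by fun_prop), stateKernel, Kernel.lintegral_comp _ _ _ hH]
  exact Kernel.lintegral_id_prod (f := fun z => ∫⁻ c, H c ∂(p z)) hH.lintegral_kernel _ _

namespace TensorMDP.IsTrajectory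

variable [IsProbabilityMeasure μ]

/-- The next state is integrated out given the history up to the action, then the action given the
history up to the state. -/
lemma lintegral_step (hd : IsTrajectory μ p π s a) (i : Fin n) {W : Ω → ℝ≥0∞}
    (hW : Measurable[historyState s a i] W)
    {g : (S × A) × S → ℝ≥0∞} (hg : Measurable g) :
    ∫⁻ ω, W ω * g ((s i.castSucc ω, a i ω), s i.succ ω) ∂μ
      = ∫⁻ ω, W ω * ∫⁻ z, g z ∂(stepKernel p π (s i.castSucc ω)) ∂μ := by
  have hs : Measurable[historyState s a i] (s i.castSucc) :=
    measurable_state_historyState (by simp)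
  have hle : historyState s a i ≤ historyAction s a i := le_sup_left
  have ha : Measurable[historyAction s a i] (a i) :=
    (comap_measurable (a i)).mono le_sup_right le_rfl
  rw [lintegral_mul_eq_of_condExp (Y := fun ω => (s i.castSucc ω, a i ω)) (X := s i.succ)
    (hd.historyAction_le i) ((hs.mono hle le_rfl).prodMk ha) (hd.measurable_state _) p
    (hd.state_law i) (hW.mono hle le_rfl) hg]
  rw [lintegral_mul_eq_of_condExp (Y := s i.castSucc) (X := a i) (hd.historyState_le i) hs
    (hd.measurable_action i) π (hd.action_law i) hW
    (g := fun y => ∫⁻ x, g (y, x) ∂(p y)) hg.lintegral_kernel_prod_right']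
  simp only [lintegral_stepKernel _ hg]

/-- Induction peels off the last transition and replaces `H` by its average after one step of the
chain, which is why `H` must vary in the induction. -/
lemma lintegral_state_add (hd : IsTrajectory μ p π s a) (i : Fin n) {W : Ω → ℝ≥0∞}
    (hW : Measurable[historyState s a i] W)
    (k : ℕ) (j : Fin (n + 1)) (hj : (j : ℕ) = i + k) {H : S → ℝ≥0∞} (hH : Measurable H) :
    ∫⁻ ω, W ω * H (s j ω) ∂μ
      = ∫⁻ ω, W ω * ∫⁻ x, H x ∂((stateKernel p π ^ k) (s i.castSucc ω)) ∂μ := by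
  induction k generalizing j H with
  | zero =>
    obtain rfl : j = i.castSucc := Fin.ext (by simpa using hj)
    have h1 : (stateKernel p π) ^ 0 = Kernel.id := pow_zero _
    simp only [h1, Kernel.lintegral_id' hH]
  | succ k ih =>
    have hlt : (i : ℕ) + k < n := by have := j.2; omega
    obtain rfl : j = (⟨i + k, hlt⟩ : Fin n).succ := Fin.ext (by simp [hj, add_assoc])
    rw [hd.lintegral_step ⟨i + k, hlt⟩ (g := fun z => H z.2)
      (hW.mono (historyState_mono (by simp [Fin.le_def])) le_rfl) (by fun_prop)]
    simp only [← lintegral_stateKernel _ hH]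
    rw [ih _ rfl hH.lintegral_kernel]
    rw [show k + 1 = 1 + k by ring]
    simp only [Kernel.pow_add, pow_one, Kernel.lintegral_comp _ _ _ hH]

lemma lintegral_step_add (hd : IsTrajectory μ p π s a) (i : Fin n) {W : Ω → ℝ≥0∞}
    (hW : Measurable[historyState s a i] W)
    (k : ℕ) (j : Fin n) (hj : (j : ℕ) = i + k) {g : (S × A) × S → ℝ≥0∞} (hg : Measurable g) :
    ∫⁻ ω, W ω * g ((s j.castSucc ω, a j ω), s j.succ ω) ∂μ
      = ∫⁻ ω, W ω * ∫⁻ x, ∫⁻ z, g z ∂(stepKernel p π x)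
        ∂((stateKernel p π ^ k) (s i.castSucc ω)) ∂μ := by
  rw [hd.lintegral_step j (hW.mono (historyState_mono (by simp [Fin.le_def, hj])) le_rfl) hg]
  exact hd.lintegral_state_add i hW k j.castSucc (by simpa using hj) hg.lintegral_kernel

end TensorMDP.IsTrajectory

end Trajectory

/-! ### Exponential moments and a Bernstein bound by blocking -/

section Concentration

variable {S A : Type*} {Ω : Type*} {n : ℕ}

/-- The value of `f` at the `x`-th transition of a path, and zero beyond its end. -/
noncomputable def transitionValue (s : Fin (n + 1) → Ω → S) (a : Fin n → Ω → A)
    (f : (S × A) × S → ℝ) (x : ℕ) (ω : Ω) : ℝ :=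
  if h : x < n then f ((s (Fin.castSucc ⟨x, h⟩) ω, a ⟨x, h⟩ ω), s (Fin.succ ⟨x, h⟩) ω) else 0

lemma abs_transitionValue_le {s : Fin (n + 1) → Ω → S}
    {a : Fin n → Ω → A} {f : (S × A) × S → ℝ} {c : ℝ} (hc0 : 0 ≤ c) (hfc : ∀ z, |f z| ≤ c)
    (x : ℕ) (ω : Ω) : |transitionValue s a f x ω| ≤ c := by
  unfold transitionValue
  split_ifs
  · exact hfc _
  · simpa using hc0

variable [MeasurableSpace S] [MeasurableSpace A] {s : Fin (n + 1) → Ω → S} {a : Fin n → Ω → A}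

lemma measurable_transitionValue {f : (S × A) × S → ℝ} (hf : Measurable f) (x : ℕ) (i : Fin n)
    (h : x < i) : Measurable[historyState s a i] (transitionValue s a f x) := by
  have hx : x < n := h.trans i.2
  have heq : transitionValue s a f x = fun ω =>
      f ((s (Fin.castSucc ⟨x, hx⟩) ω, a ⟨x, hx⟩ ω), s (Fin.succ ⟨x, hx⟩) ω) := by
    funext ω; simp [transitionValue, hx]
  rw [heq]
  refine hf.comp (Measurable.prodMk (Measurable.prodMk ?_ ?_) ?_)
  · exact measurable_state_historyState (by simpa using h.le)
  · exact measurable_action_historyState h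
  · exact measurable_state_historyState (by simpa using h)

variable {p : Kernel (S × A) S} {π : Kernel S A} [mΩ : MeasurableSpace Ω] {μ : Measure Ω}

lemma measurable_transitionValue' (hd : IsTrajectory μ p π s a) {f : (S × A) × S → ℝ}
    (hf : Measurable f) (x : ℕ) : Measurable (transitionValue s a f x) := by
  unfold transitionValue
  split_ifs with h
  · exact hf.comp (((hd.measurable_state _).prodMk (hd.measurable_action _)).prodMk
      (hd.measurable_state _))
  · exact measurable_const

variable [IsMarkovKernel p] [IsMarkovKernel π]

/-- For |f| ≤ 1 one has eᶠ ≤ 1 + f + f², so in stationarity the exponential moment is at most 1 + V.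
The conditional moment, as a function of the state, has oscillation at most 4c, of which 4c / 2ᴹ
survives the waiting time. Finally 1 + x ≤ eˣ puts the bound in multiplicative form. -/
lemma lintegral_exp_stepKernel_le {T : ℕ} (hT : MixesBy (stateKernel p π) T) {ξ : Measure S}
    [IsProbabilityMeasure ξ] (hξ : Kernel.Invariant (stateKernel p π) ξ)
    {f : (S × A) × S → ℝ} (hf : Measurable f) {c V : ℝ} (hc1 : c ≤ 1) (hfc : ∀ z, |f z| ≤ c)
    (hmean : ∫ z, f z ∂(ξ.bind (stepKernel p π)) = 0)
    (hvar : ∫ z, f z ^ 2 ∂(ξ.bind (stepKernel p π)) ≤ V) (M k : ℕ) (hk : T * M ≤ k) (x : S) :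
    ∫⁻ x', ∫⁻ z, ENNReal.ofReal (Real.exp (f z)) ∂(stepKernel p π x')
        ∂((stateKernel p π ^ k) x) ≤ ENNReal.ofReal (Real.exp (V + 4 * c / 2 ^ M)) := by
  have he : ∀ z, |Real.exp (f z) - 1| ≤ 2 * c := fun z =>
    (Real.abs_exp_sub_one_le ((hfc z).trans hc1)).trans (by linarith [hfc z])
  have hem : Measurable fun z => Real.exp (f z) := hf.exp
  have heb : ∀ z, |Real.exp (f z)| ≤ 1 + 2 * c := fun z => by
    have := abs_le.1 (he z)
    rw [abs_of_pos (Real.exp_pos _)]; linarith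
  have hei : ∀ (μ : Measure ((S × A) × S)) [IsProbabilityMeasure μ],
      Integrable (fun z => Real.exp (f z)) μ := fun μ _ => integrable_of_abs_le hem heb
  set H : S → ℝ := fun x => ∫ z, Real.exp (f z) ∂(stepKernel p π x) with hH
  have hHm : Measurable H :=
    (hem.stronglyMeasurable.integral_kernel (κ := stepKernel p π)).measurable
  have hHlo : ∀ x, 1 - 2 * c ≤ H x := fun x => by
    have := integral_mono (integrable_const (1 - 2 * c)) (hei (stepKernel p π x)) fun z => by
      have := abs_le.1 (he z); show 1 - 2 * c ≤ Real.exp (f z); linarith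
    simpa using this
  have hHhi : ∀ x, H x ≤ 1 + 2 * c := fun x => by
    have := integral_mono (hei (stepKernel p π x)) (integrable_const (1 + 2 * c)) fun z => by
      have := abs_le.1 (he z); show Real.exp (f z) ≤ 1 + 2 * c; linarith
    simpa using this
  have hH0 : ∀ x, 0 ≤ H x := fun x => integral_nonneg fun z => (Real.exp_pos _).le
  have hosc : HasOscLE H (4 * c) :=
    ⟨hHm, ⟨1 + 2 * c, fun x => by rw [abs_of_nonneg (hH0 x)]; exact hHhi x⟩,
      fun x y => by linarith [hHlo y, hHhi x]⟩
  have hstat : ∫ x, H x ∂ξ ≤ 1 + V := by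
    rw [hH, ← integral_bind_kernel ξ (stepKernel p π) hem heb]
    have hprob : IsProbabilityMeasure (ξ.bind (stepKernel p π)) := inferInstance
    have hfi : Integrable f (ξ.bind (stepKernel p π)) := integrable_of_abs_le hf hfc
    have hf2i : Integrable (fun z => f z ^ 2) (ξ.bind (stepKernel p π)) :=
      integrable_of_abs_le (hf.pow_const 2) (C := 1) fun z => by
        rw [abs_pow]; exact pow_le_one₀ (abs_nonneg _) ((hfc z).trans hc1)
    have h1i : Integrable (fun z => 1 + f z) (ξ.bind (stepKernel p π)) :=
      (integrable_const _).add hfi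
    have := integral_mono (hei (ξ.bind (stepKernel p π))) (h1i.add hf2i) fun z => by
        have := abs_le.1 (Real.abs_exp_sub_one_sub_id_le ((hfc z).trans hc1))
        show Real.exp (f z) ≤ 1 + f z + f z ^ 2
        linarith
    simp only [Pi.add_apply] at this
    rw [integral_add h1i hf2i, integral_add (integrable_const _) hfi,
      hmean] at this
    simp only [integral_const, probReal_univ, smul_eq_mul, one_mul] at this
    linarith
  have hmain := hosc.integral_pow_le (stateKernel p π) hT ξ hξ M k hk x
  have h1 : ∀ x', ∫⁻ z, ENNReal.ofReal (Real.exp (f z)) ∂(stepKernel p π x')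
      = ENNReal.ofReal (H x') := fun x' =>
    (ofReal_integral_eq_lintegral_ofReal (hei _) (ae_of_all _ fun z => (Real.exp_pos _).le)).symm
  simp only [h1]
  rw [← ofReal_integral_eq_lintegral_ofReal (hosc.integrable _) (ae_of_all _ hH0)]
  refine ENNReal.ofReal_le_ofReal ?_
  have := Real.add_one_le_exp (V + 4 * c / 2 ^ M)
  linarith

variable [IsProbabilityMeasure μ]

namespace TensorMDP.IsTrajectory

/-- Conditioning successively on the past, every factor but the first is preceded by a waiting time
long enough to mix. The first factor is bounded only by eᶜ, since the initial distribution is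
arbitrary. -/
lemma lintegral_prod_exp_le (hd : IsTrajectory μ p π s a) {T : ℕ} (hT1 : 1 ≤ T)
    (hT : MixesBy (stateKernel p π) T) {ξ : Measure S}
    [IsProbabilityMeasure ξ] (hξ : Kernel.Invariant (stateKernel p π) ξ)
    {f : (S × A) × S → ℝ} (hf : Measurable f) {c V : ℝ} (hc0 : 0 ≤ c) (hc1 : c ≤ 1)
    (hfc : ∀ z, |f z| ≤ c) (hmean : ∫ z, f z ∂(ξ.bind (stepKernel p π)) = 0)
    (hvar : ∫ z, f z ^ 2 ∂(ξ.bind (stepKernel p π)) ≤ V) (M j k : ℕ) :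
    ∫⁻ ω, ∏ i ∈ Finset.range (k + 1),
        ENNReal.ofReal (Real.exp (transitionValue s a f (j + T * (M + 1) * i) ω)) ∂μ
      ≤ ENNReal.ofReal (Real.exp (c + k * (V + 4 * c / 2 ^ M))) := by
  have hV : 0 ≤ V := le_trans (integral_nonneg fun z => sq_nonneg _) hvar
  have hpos : 0 ≤ V + 4 * c / 2 ^ M := by positivity
  induction k with
  | zero =>
    have : ∀ ω, ∏ i ∈ Finset.range (0 + 1),
        ENNReal.ofReal (Real.exp (transitionValue s a f (j + T * (M + 1) * i) ω))
        ≤ ENNReal.ofReal (Real.exp c) := fun ω => by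
      simp only [zero_add, Finset.range_one, Finset.prod_singleton]
      exact ENNReal.ofReal_le_ofReal (Real.exp_le_exp.2
        ((le_abs_self _).trans (abs_transitionValue_le hc0 hfc _ _)))
    refine (lintegral_mono this).trans ?_
    simp
  | succ k ih =>
    set ℓ := T * (M + 1) with hℓ
    have hℓ1 : 1 ≤ ℓ := Nat.mul_pos hT1 (Nat.succ_pos M)
    -- A transition ends one step after it starts, so only ℓ − 1 steps separate it from the next one
    -- used. The extra `T ≥ 1` in ℓ covers this loss.
    have hgap : T * M ≤ ℓ - 1 := by
      have : ℓ = T * M + T := by rw [hℓ]; ring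
      omega
    simp only [Finset.prod_range_succ _ (k + 1)]
    have hexp : Real.exp (c + ((k + 1 : ℕ) : ℝ) * (V + 4 * c / 2 ^ M))
        = Real.exp (c + k * (V + 4 * c / 2 ^ M)) * Real.exp (V + 4 * c / 2 ^ M) := by
      rw [← Real.exp_add]; push_cast; ring_nf
    by_cases hlt : j + ℓ * (k + 1) < n
    · have hi : j + ℓ * k + 1 < n ∨ j + ℓ * k + 1 = j + ℓ * (k + 1) := by
        have : ℓ * (k + 1) = ℓ * k + ℓ := by ring
        omega
      have hi' : j + ℓ * k + 1 < n := by omega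
      let i : Fin n := ⟨j + ℓ * k + 1, hi'⟩
      have hW : Measurable[historyState s a i] fun ω => ∏ x ∈ Finset.range (k + 1),
          ENNReal.ofReal (Real.exp (transitionValue s a f (j + ℓ * x) ω)) := by
        refine Finset.measurable_fun_prod _ fun x hx => ?_
        refine ENNReal.measurable_ofReal.comp (Real.measurable_exp.comp ?_)
        refine measurable_transitionValue hf _ i ?_
        have : ℓ * x ≤ ℓ * k := Nat.mul_le_mul_left _ (by simpa [Nat.lt_succ_iff] using hx)
        show j + ℓ * x < j + ℓ * k + 1
        omega
      have heq : ∀ ω, transitionValue s a f (j + ℓ * (k + 1)) ω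
          = f ((s (Fin.castSucc ⟨_, hlt⟩) ω, a ⟨_, hlt⟩ ω), s (Fin.succ ⟨_, hlt⟩) ω) := fun ω => by
        simp [transitionValue, hlt]
      simp only [heq]
      rw [hd.lintegral_step_add i hW (ℓ - 1) ⟨_, hlt⟩ ?_
        (g := fun z => ENNReal.ofReal (Real.exp (f z))) (by fun_prop)]
      · refine (lintegral_mono fun ω => mul_le_mul_right (lintegral_exp_stepKernel_le hT hξ hf hc1
          hfc hmean hvar M (ℓ - 1) hgap _) _).trans ?_
        rw [lintegral_mul_const _ (hW.mono (hd.historyState_le i) le_rfl), hexp,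
          ENNReal.ofReal_mul (Real.exp_pos _).le]
        exact mul_le_mul_left ih _
      · show j + ℓ * (k + 1) = j + ℓ * k + 1 + (ℓ - 1)
        have : ℓ * (k + 1) = ℓ * k + ℓ := by ring
        omega
    -- Past the end of the path the value is zero, so the extra factor is 1.
    · have heq : ∀ ω, transitionValue s a f (j + ℓ * (k + 1)) ω = 0 := fun ω => by
        simp [transitionValue, hlt]
      simp only [heq, Real.exp_zero, ENNReal.ofReal_one, mul_one]
      refine ih.trans (ENNReal.ofReal_le_ofReal ?_)
      rw [hexp]
      exact le_mul_of_one_le_right (Real.exp_pos _).le (Real.one_le_exp hpos)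

end TensorMDP.IsTrajectory

lemma sum_range_mul_eq (F : ℕ → ℝ) (ℓ k : ℕ) :
    ∑ x ∈ Finset.range (ℓ * k), F x
      = ∑ j ∈ Finset.range ℓ, ∑ i ∈ Finset.range k, F (j + ℓ * i) := by
  induction k with
  | zero => simp
  | succ k ih =>
    rw [Nat.mul_succ, Finset.sum_range_add, ih, ← Finset.sum_add_distrib]
    refine Finset.sum_congr rfl fun j _ => ?_
    rw [Finset.sum_range_succ, add_comm (ℓ * k) j]

namespace TensorMDP.IsTrajectory

/-- The sum over the path divided by ℓ is an average of ℓ sums over residue classes modulo ℓ.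
Jensen's inequality for exp bounds its exponential moment by the average of those of the classes, so
dependence between classes is irrelevant. -/
lemma lintegral_exp_sum_le (hd : IsTrajectory μ p π s a) {T : ℕ} (hT1 : 1 ≤ T)
    (hT : MixesBy (stateKernel p π) T) {ξ : Measure S}
    [IsProbabilityMeasure ξ] (hξ : Kernel.Invariant (stateKernel p π) ξ)
    {f : (S × A) × S → ℝ} (hf : Measurable f) {c V : ℝ} (hc0 : 0 ≤ c) (hc1 : c ≤ 1)
    (hfc : ∀ z, |f z| ≤ c) (hmean : ∫ z, f z ∂(ξ.bind (stepKernel p π)) = 0)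
    (hvar : ∫ z, f z ^ 2 ∂(ξ.bind (stepKernel p π)) ≤ V) (M : ℕ) :
    ∫⁻ ω, ENNReal.ofReal (Real.exp (((T * (M + 1) : ℕ) : ℝ)⁻¹ *
        ∑ x ∈ Finset.range n, transitionValue s a f x ω)) ∂μ
      ≤ ENNReal.ofReal
        (Real.exp (c + (n : ℝ) / ((T * (M + 1) : ℕ) : ℝ) * (V + 4 * c / 2 ^ M))) := by
  have hV : 0 ≤ V := le_trans (integral_nonneg fun z => sq_nonneg _) hvar
  set ℓ := T * (M + 1) with hℓ
  have hℓ1 : 0 < ℓ := Nat.mul_pos hT1 (Nat.succ_pos M)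
  have hℓr : (0 : ℝ) < ℓ := by exact_mod_cast hℓ1
  set k := n / ℓ with hk
  have hkn : (k : ℝ) ≤ (n : ℝ) / ℓ := Nat.cast_div_le
  -- All classes are given `k + 1` terms; indices from `n` on contribute zero.
  have hcover : n ≤ ℓ * (k + 1) := (Nat.lt_mul_div_succ n hℓ1).le
  have hsum : ∀ ω, ∑ x ∈ Finset.range n, transitionValue s a f x ω
      = ∑ j ∈ Finset.range ℓ, ∑ i ∈ Finset.range (k + 1),
        transitionValue s a f (j + ℓ * i) ω := fun ω => by
    rw [← sum_range_mul_eq (fun x => transitionValue s a f x ω)]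
    refine Finset.sum_subset (Finset.range_mono hcover) fun x _ hx => ?_
    simp only [Finset.mem_range] at hx
    simp [transitionValue, hx]
  have hjensen : ∀ ω, ENNReal.ofReal (Real.exp ((ℓ : ℝ)⁻¹ *
        ∑ x ∈ Finset.range n, transitionValue s a f x ω))
      ≤ ENNReal.ofReal ((ℓ : ℝ)⁻¹) * ∑ j ∈ Finset.range ℓ, ∏ i ∈ Finset.range (k + 1),
        ENNReal.ofReal (Real.exp (transitionValue s a f (j + ℓ * i) ω)) := fun ω => by
    have h1 := convexOn_exp.map_sum_le (t := Finset.range ℓ) (w := fun _ => (ℓ : ℝ)⁻¹)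
      (p := fun j => ∑ i ∈ Finset.range (k + 1), transitionValue s a f (j + ℓ * i) ω)
      (fun _ _ => by positivity) (by simp [hℓr.ne']) (fun _ _ => Set.mem_univ _)
    simp only [smul_eq_mul, ← Finset.mul_sum] at h1
    rw [hsum]
    refine (ENNReal.ofReal_le_ofReal h1).trans (le_of_eq ?_)
    rw [ENNReal.ofReal_mul (by positivity), ENNReal.ofReal_sum_of_nonneg
      fun _ _ => (Real.exp_pos _).le]
    congr 1
    refine Finset.sum_congr rfl fun j _ => ?_
    rw [Real.exp_sum, ENNReal.ofReal_prod_of_nonneg fun _ _ => (Real.exp_pos _).le]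
  have hmeas : ∀ x, Measurable fun ω => ENNReal.ofReal (Real.exp (transitionValue s a f x ω)) :=
    fun x => ENNReal.measurable_ofReal.comp
      (Real.measurable_exp.comp (measurable_transitionValue' hd hf x))
  refine (lintegral_mono hjensen).trans ?_
  rw [lintegral_const_mul _ (by fun_prop), lintegral_finsetSum _ (by fun_prop)]
  refine (mul_le_mul_right (Finset.sum_le_sum fun j _ =>
    hd.lintegral_prod_exp_le hT1 hT hξ hf hc0 hc1 hfc hmean hvar M j k) _).trans ?_
  rw [Finset.sum_const, Finset.card_range, nsmul_eq_mul, ← mul_assoc,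
    ← ENNReal.ofReal_natCast ℓ, ← ENNReal.ofReal_mul (by positivity),
    inv_mul_cancel₀ hℓr.ne', ENNReal.ofReal_one, one_mul]
  gcongr

/-- A Bernstein-type inequality for the empirical mean of a function of the transitions along a
trajectory. -/
lemma measure_le_sum_transition_le (hd : IsTrajectory μ p π s a) {T : ℕ} (hT1 : 1 ≤ T)
    (hT : MixesBy (stateKernel p π) T) {ξ : Measure S}
    [IsProbabilityMeasure ξ] (hξ : Kernel.Invariant (stateKernel p π) ξ)
    {y : (S × A) × S → ℝ} (hy : Measurable y) {b v θ ε : ℝ} (hb0 : 0 ≤ b)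
    (hyb : ∀ z, |y z| ≤ b) (hvar : ∫ z, y z ^ 2 ∂(ξ.bind (stepKernel p π)) ≤ v)
    (hθ : 0 ≤ θ) (hθb : θ * (2 * b) ≤ 1) (hn : 0 < n) (M : ℕ) :
    μ.real {ω | ε ≤ (n : ℝ)⁻¹ * (∑ x : Fin n, y ((s x.castSucc ω, a x ω), s x.succ ω))
        - ∫ z, y z ∂(ξ.bind (stepKernel p π))}
      ≤ Real.exp (θ * (2 * b) + (n : ℝ) / ((T * (M + 1) : ℕ) : ℝ) *
        (θ ^ 2 * v + 4 * (θ * (2 * b)) / 2 ^ M - θ * ε)) := by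
  set ρ := ξ.bind (stepKernel p π) with hρ
  have hprob : IsProbabilityMeasure ρ := by rw [hρ]; infer_instance
  set m := ∫ z, y z ∂ρ with hm
  have hyi : Integrable y ρ := integrable_of_abs_le hy hyb
  have hmb : |m| ≤ b := by
    have := norm_integral_le_of_norm_le_const (μ := ρ) (f := y) (C := b) (ae_of_all _ hyb)
    simpa using this
  -- Centering costs a factor 2 in the sup bound, as |m| ≤ b, and does not increase the second
  -- moment.
  set f : (S × A) × S → ℝ := fun z => θ * (y z - m) with hfdef
  have hf : Measurable f := (hy.sub_const m).const_mul θ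
  have hfc : ∀ z, |f z| ≤ θ * (2 * b) := fun z => by
    rw [hfdef]
    simp only [abs_mul, abs_of_nonneg hθ]
    refine mul_le_mul_of_nonneg_left ?_ hθ
    exact (abs_sub _ _).trans (by linarith [hyb z])
  have hmean : ∫ z, f z ∂ρ = 0 := by
    rw [hfdef, integral_const_mul, integral_sub hyi (integrable_const _)]
    simp [hm]
  have hy2i : Integrable (fun z => y z ^ 2) ρ :=
    integrable_of_abs_le (hy.pow_const 2) (C := b ^ 2) fun z => by
      rw [abs_pow]; exact pow_le_pow_left₀ (abs_nonneg _) (hyb z) 2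
  have hfvar : ∫ z, f z ^ 2 ∂ρ ≤ θ ^ 2 * v := by
    have h1 : ∀ z, f z ^ 2 = θ ^ 2 * (y z ^ 2 - (2 * m * y z - m ^ 2)) := fun z => by
      rw [hfdef]; ring
    simp only [h1]
    have hlin : Integrable (fun z => 2 * m * y z - m ^ 2) ρ :=
      (hyi.const_mul _).sub (integrable_const _)
    rw [integral_const_mul, integral_sub hy2i hlin, integral_sub (hyi.const_mul _) (integrable_const _), integral_const_mul, ← hm]
    simp only [integral_const, probReal_univ, smul_eq_mul, one_mul]
    exact mul_le_mul_of_nonneg_left (by nlinarith [sq_nonneg m]) (sq_nonneg θ)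
  have hmgf := hd.lintegral_exp_sum_le hT1 hT hξ hf (by positivity) hθb hfc hmean hfvar M
  set ℓ := T * (M + 1) with hℓ
  have hℓ1 : 0 < ℓ := Nat.mul_pos hT1 (Nat.succ_pos M)
  have hℓr : (0 : ℝ) < ℓ := by exact_mod_cast hℓ1
  have hnr : (0 : ℝ) < n := by exact_mod_cast hn
  have hval : ∀ ω, ∑ x ∈ Finset.range n, transitionValue s a f x ω
      = θ * n * ((n : ℝ)⁻¹ * (∑ x : Fin n, y ((s x.castSucc ω, a x ω), s x.succ ω)) - m) := by
    intro ω
    rw [Finset.sum_range]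
    have : ∀ x : Fin n, transitionValue s a f x ω
        = θ * (y ((s x.castSucc ω, a x ω), s x.succ ω) - m) := fun x => by
      simp [transitionValue, hfdef]
    simp only [this]
    rw [← Finset.mul_sum, Finset.sum_sub_distrib]
    simp only [Finset.sum_const, Finset.card_univ, Fintype.card_fin, nsmul_eq_mul]
    field_simp
  have hsub : {ω | ε ≤ (n : ℝ)⁻¹ * (∑ x : Fin n, y ((s x.castSucc ω, a x ω), s x.succ ω)) - m}
      ⊆ {ω | ENNReal.ofReal (Real.exp ((n : ℝ) / ℓ * (θ * ε))) ≤
        ENNReal.ofReal (Real.exp ((ℓ : ℝ)⁻¹ *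
          ∑ x ∈ Finset.range n, transitionValue s a f x ω))} := fun ω hω => by
    refine ENNReal.ofReal_le_ofReal (Real.exp_le_exp.2 ?_)
    rw [hval]
    have hω' : ε ≤ _ := hω
    calc (n : ℝ) / ℓ * (θ * ε) = (ℓ : ℝ)⁻¹ * (θ * n * ε) := by field_simp
      _ ≤ _ := by gcongr
  have hmeas : Measurable fun ω => ENNReal.ofReal (Real.exp ((ℓ : ℝ)⁻¹ *
      ∑ x ∈ Finset.range n, transitionValue s a f x ω)) := by
    refine ENNReal.measurable_ofReal.comp (Real.measurable_exp.comp (Measurable.const_mul ?_ _))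
    exact Finset.measurable_fun_sum _ fun x _ => measurable_transitionValue' hd hf x
  have hmarkov := (mul_meas_ge_le_lintegral (μ := μ) hmeas
    (ENNReal.ofReal (Real.exp ((n : ℝ) / ℓ * (θ * ε))))).trans hmgf
  have hle : ENNReal.ofReal (Real.exp ((n : ℝ) / ℓ * (θ * ε))) * μ {ω | ε ≤ (n : ℝ)⁻¹ *
      (∑ x : Fin n, y ((s x.castSucc ω, a x ω), s x.succ ω)) - m} ≤ _ :=
    (mul_le_mul_right (measure_mono hsub) _).trans hmarkov
  have hreal := ENNReal.toReal_mono ENNReal.ofReal_ne_top hle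
  rw [ENNReal.toReal_mul, ENNReal.toReal_ofReal (Real.exp_pos _).le,
    ENNReal.toReal_ofReal (Real.exp_pos _).le] at hreal
  have hexp : Real.exp (θ * (2 * b) + (n : ℝ) / ℓ *
      (θ ^ 2 * v + 4 * (θ * (2 * b)) / 2 ^ M - θ * ε))
      = Real.exp (θ * (2 * b) + (n : ℝ) / ℓ * (θ ^ 2 * v + 4 * (θ * (2 * b)) / 2 ^ M))
        / Real.exp ((n : ℝ) / ℓ * (θ * ε)) := by
    rw [← Real.exp_sub]; congr 1; ring
  rw [hexp, le_div_iff₀ (Real.exp_pos _), mul_comm]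
  exact hreal

end TensorMDP.IsTrajectory

end Concentration

/-! ### Nets of the Euclidean sphere -/

section Nets

/-- The unit sphere of `ℝᵈ` has a `1/2`-net with at most `5 ^ d` points. -/
lemma exists_half_net (d : ℕ) : ∃ N : Finset (EuclideanSpace ℝ (Fin d)), N.card ≤ 5 ^ d ∧
    (∀ x ∈ N, ‖x‖ = 1) ∧ ∀ x : EuclideanSpace ℝ (Fin d), ‖x‖ = 1 → ∃ y ∈ N, ‖x - y‖ ≤ 1 / 2 := by
  classical
  let sep : Finset (EuclideanSpace ℝ (Fin d)) → Prop := fun N =>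
    (∀ x ∈ N, ‖x‖ = 1) ∧ ∀ x ∈ N, ∀ y ∈ N, x ≠ y → 1 / 2 ≤ ‖x - y‖
  have hcard : ∀ N, sep N → N.card ≤ 5 ^ d := by
    rintro N ⟨h1, h2⟩
    have hinj : Function.Injective fun x : EuclideanSpace ℝ (Fin d) => (2 : ℝ) • x :=
      smul_right_injective _ two_ne_zero
    -- Doubling gives points of norm 2 at mutual distance at least 1, and a ball of radius 2 holds
    -- at most 5ᵈ of those.
    have := Besicovitch.card_le_of_separated (N.image fun x => (2 : ℝ) • x)
      (by
        simp only [Finset.mem_image, forall_exists_index, and_imp]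
        rintro _ x hx rfl
        rw [norm_smul, h1 x hx]; norm_num)
      (by
        simp only [Finset.mem_image, forall_exists_index, and_imp]
        rintro _ x hx rfl _ y hy rfl hxy
        rw [← smul_sub, norm_smul, Real.norm_eq_abs, abs_two]
        linarith [h2 x hx y hy fun h => hxy (by rw [h])])
    rwa [Finset.card_image_of_injective _ hinj, finrank_euclideanSpace_fin] at this
  -- A separated set of maximal cardinality is a net: a point farther than 1/2 from all its elements
  -- could be added.
  obtain ⟨k, ⟨N, hN, hNk⟩, hmax⟩ : ∃ k, (∃ N, sep N ∧ N.card = k) ∧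
      ∀ k', (∃ N, sep N ∧ N.card = k') → k' ≤ k := by
    have hne : ∃ N, sep N ∧ N.card = 0 := ⟨∅, by simp [sep], rfl⟩
    refine ⟨Nat.findGreatest (fun k => ∃ N, sep N ∧ N.card = k) (5 ^ d),
      Nat.findGreatest_spec (P := fun k => ∃ N, sep N ∧ N.card = k) (Nat.zero_le _) hne,
      fun k' hk' => Nat.le_findGreatest ?_ hk'⟩
    obtain ⟨N, hN, rfl⟩ := hk'
    exact hcard N hN
  refine ⟨N, hcard N hN, hN.1, fun x hx => ?_⟩
  by_contra! hfar
  have hxN : x ∉ N := fun h => by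
    have := hfar x h
    norm_num at this
  have hsep : sep (insert x N) := by
    refine ⟨fun y hy => ?_, fun y hy z hz hyz => ?_⟩
    · rcases Finset.mem_insert.1 hy with rfl | hy
      · exact hx
      · exact hN.1 y hy
    · rcases Finset.mem_insert.1 hy with hyx | hyN <;>
        rcases Finset.mem_insert.1 hz with hzx | hzN
      · exact absurd (hyx.trans hzx.symm) hyz
      · rw [hyx]; exact (hfar z hzN).le
      · rw [hzx, norm_sub_rev]; exact (hfar y hyN).le
      · exact hN.2 y hyN z hzN hyz
  have := hmax _ ⟨_, hsep, rfl⟩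
  rw [Finset.card_insert_of_notMem hxN] at this
  omega

/-- A linear functional is at most twice its maximum over a `1/2`-net of the sphere. -/
lemma linear_le_of_net {d : ℕ} {N : Finset (EuclideanSpace ℝ (Fin d))}
    (hN : ∀ x : EuclideanSpace ℝ (Fin d), ‖x‖ = 1 → ∃ y ∈ N, ‖x - y‖ ≤ 1 / 2)
    {f : EuclideanSpace ℝ (Fin d) → ℝ} (hf : IsLinearMap ℝ f) {c : ℝ} (hc : 0 ≤ c)
    (h : ∀ y ∈ N, f y ≤ c) (x : EuclideanSpace ℝ (Fin d)) : f x ≤ 2 * c * ‖x‖ := by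
  let g : EuclideanSpace ℝ (Fin d) →L[ℝ] ℝ := LinearMap.toContinuousLinearMap (hf.mk' f)
  have hg : ∀ x, g x = f x := fun x => rfl
  -- Replacing a unit vector by a nearby net point costs at most ‖g‖/2, which is then absorbed into
  -- the left side to give ‖g‖ ≤ 2c.
  have hunit : ∀ x : EuclideanSpace ℝ (Fin d), ‖x‖ = 1 → g x ≤ c + ‖g‖ / 2 := fun x hx => by
    obtain ⟨y, hy, hxy⟩ := hN x hx
    have h1 : g x = g y + g (x - y) := by rw [← map_add]; congr 1; abel
    have h2 : g (x - y) ≤ ‖g‖ * ‖x - y‖ := (le_abs_self _).trans (g.le_opNorm _)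
    have h3 : ‖g‖ * ‖x - y‖ ≤ ‖g‖ * (1 / 2) := mul_le_mul_of_nonneg_left hxy (norm_nonneg _)
    have h4 : g y ≤ c := h y hy
    linarith
  have hnorm : ‖g‖ ≤ c + ‖g‖ / 2 := by
    refine g.opNorm_le_of_unit_norm (by positivity) fun x hx => ?_
    rw [Real.norm_eq_abs]
    refine abs_le.2 ⟨?_, hunit x hx⟩
    have := hunit (-x) (by rwa [norm_neg])
    rw [map_neg] at this
    linarith
  rw [← hg]
  refine ((le_abs_self _).trans (g.le_opNorm x)).trans ?_
  exact mul_le_mul_of_nonneg_right (by linarith) (norm_nonneg _)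

end Nets

/-! ### Trilinear forms and the tensor spectral norm -/

section Trilinear

variable {p q t : ℕ}

lemma isLinearMap_trilin_fst (X : Tensor3 p q t) (v : EuclideanSpace ℝ (Fin q))
    (w : EuclideanSpace ℝ (Fin t)) : IsLinearMap ℝ fun u => trilin X u v w where
  map_add u u' := by
    simp only [trilin, ← Finset.sum_add_distrib, PiLp.add_apply]
    exact Finset.sum_congr rfl fun i _ => Finset.sum_congr rfl fun j _ =>
      Finset.sum_congr rfl fun k _ => by ring
  map_smul c u := by
    simp only [trilin, PiLp.smul_apply, smul_eq_mul, Finset.mul_sum]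
    exact Finset.sum_congr rfl fun i _ => Finset.sum_congr rfl fun j _ =>
      Finset.sum_congr rfl fun k _ => by ring

lemma isLinearMap_trilin_snd (X : Tensor3 p q t) (u : EuclideanSpace ℝ (Fin p))
    (w : EuclideanSpace ℝ (Fin t)) : IsLinearMap ℝ fun v => trilin X u v w where
  map_add v v' := by
    simp only [trilin, ← Finset.sum_add_distrib, PiLp.add_apply]
    exact Finset.sum_congr rfl fun i _ => Finset.sum_congr rfl fun j _ =>
      Finset.sum_congr rfl fun k _ => by ring
  map_smul c v := by
    simp only [trilin, PiLp.smul_apply, smul_eq_mul, Finset.mul_sum]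
    exact Finset.sum_congr rfl fun i _ => Finset.sum_congr rfl fun j _ =>
      Finset.sum_congr rfl fun k _ => by ring

lemma isLinearMap_trilin_thd (X : Tensor3 p q t) (u : EuclideanSpace ℝ (Fin p))
    (v : EuclideanSpace ℝ (Fin q)) : IsLinearMap ℝ fun w => trilin X u v w where
  map_add w w' := by
    simp only [trilin, ← Finset.sum_add_distrib, PiLp.add_apply]
    exact Finset.sum_congr rfl fun i _ => Finset.sum_congr rfl fun j _ =>
      Finset.sum_congr rfl fun k _ => by ring
  map_smul c w := by
    simp only [trilin, PiLp.smul_apply, smul_eq_mul, Finset.mul_sum]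
    exact Finset.sum_congr rfl fun i _ => Finset.sum_congr rfl fun j _ =>
      Finset.sum_congr rfl fun k _ => by ring

lemma trilin_sub (X Y : Tensor3 p q t) (u : EuclideanSpace ℝ (Fin p))
    (v : EuclideanSpace ℝ (Fin q)) (w : EuclideanSpace ℝ (Fin t)) :
    trilin (X - Y) u v w = trilin X u v w - trilin Y u v w := by
  simp only [trilin, ← Finset.sum_sub_distrib, Pi.sub_apply, sub_mul]

/-- The arguments are released from their nets one at a time, each costing a factor 2 by linearity
in that slot. -/
lemma trilin_le_of_net {N₁ : Finset (EuclideanSpace ℝ (Fin p))}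
    {N₂ : Finset (EuclideanSpace ℝ (Fin q))} {N₃ : Finset (EuclideanSpace ℝ (Fin t))}
    (h₁ : ∀ x : EuclideanSpace ℝ (Fin p), ‖x‖ = 1 → ∃ y ∈ N₁, ‖x - y‖ ≤ 1 / 2)
    (h₂ : ∀ x : EuclideanSpace ℝ (Fin q), ‖x‖ = 1 → ∃ y ∈ N₂, ‖x - y‖ ≤ 1 / 2)
    (h₃ : ∀ x : EuclideanSpace ℝ (Fin t), ‖x‖ = 1 → ∃ y ∈ N₃, ‖x - y‖ ≤ 1 / 2)
    {X : Tensor3 p q t} {c : ℝ} (hc : 0 ≤ c)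
    (h : ∀ u ∈ N₁, ∀ v ∈ N₂, ∀ w ∈ N₃, trilin X u v w ≤ c) (u : EuclideanSpace ℝ (Fin p))
    (v : EuclideanSpace ℝ (Fin q)) (w : EuclideanSpace ℝ (Fin t)) :
    trilin X u v w ≤ 8 * c * (‖u‖ * ‖v‖ * ‖w‖) := by
  have e1 : ∀ v ∈ N₂, ∀ w ∈ N₃, ∀ u, trilin X u v w ≤ 2 * c * ‖u‖ := fun v hv w hw u =>
    linear_le_of_net h₁ (isLinearMap_trilin_fst X v w) hc (fun u hu => h u hu v hv w hw) u
  have e2 : ∀ w ∈ N₃, ∀ u v, trilin X u v w ≤ 2 * (2 * c * ‖u‖) * ‖v‖ := fun w hw u v =>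
    linear_le_of_net h₂ (isLinearMap_trilin_snd X u w) (by positivity)
      (fun v hv => e1 v hv w hw u) v
  have e3 := linear_le_of_net h₃ (isLinearMap_trilin_thd X u v)
    (c := 2 * (2 * c * ‖u‖) * ‖v‖) (by positivity) (fun w hw => e2 w hw u v) w
  exact e3.trans (le_of_eq (by ring))

lemma abs_apply_le_norm {d : ℕ} (u : EuclideanSpace ℝ (Fin d)) (i : Fin d) : |u i| ≤ ‖u‖ :=
  PiLp.norm_apply_le u i

lemma bddAbove_trilin (X : Tensor3 p q t) : BddAbove {x : ℝ | ∃ (u : EuclideanSpace ℝ (Fin p))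
    (v : EuclideanSpace ℝ (Fin q)) (w : EuclideanSpace ℝ (Fin t)),
    ‖u‖ = 1 ∧ ‖v‖ = 1 ∧ ‖w‖ = 1 ∧ x = trilin X u v w} := by
  refine ⟨∑ i, ∑ j, ∑ k, |X i j k|, ?_⟩
  rintro _ ⟨u, v, w, hu, hv, hw, rfl⟩
  refine Finset.sum_le_sum fun i _ => Finset.sum_le_sum fun j _ => Finset.sum_le_sum fun k _ => ?_
  refine (le_abs_self _).trans ?_
  rw [abs_mul, abs_mul, abs_mul]
  have h1 : |u i| ≤ 1 := (abs_apply_le_norm u i).trans hu.le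
  have h2 : |v j| ≤ 1 := (abs_apply_le_norm v j).trans hv.le
  have h3 : |w k| ≤ 1 := (abs_apply_le_norm w k).trans hw.le
  refine mul_le_of_le_one_right (abs_nonneg _) ?_
  exact mul_le_one₀ (mul_le_one₀ h1 (abs_nonneg _) h2) (abs_nonneg _) h3

lemma trilin_le_tensorNorm (X : Tensor3 p q t) {u : EuclideanSpace ℝ (Fin p)}
    {v : EuclideanSpace ℝ (Fin q)} {w : EuclideanSpace ℝ (Fin t)} (hu : ‖u‖ = 1) (hv : ‖v‖ = 1)
    (hw : ‖w‖ = 1) : trilin X u v w ≤ tensorNorm X :=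
  le_csSup (bddAbove_trilin X) ⟨u, v, w, hu, hv, hw, rfl⟩

/-- Nonnegativity of `c` matters when a dimension is zero: there are then no unit vectors and the
supremum takes the value 0. -/
lemma tensorNorm_le {X : Tensor3 p q t} {c : ℝ} (hc : 0 ≤ c)
    (h : ∀ (u : EuclideanSpace ℝ (Fin p)) (v : EuclideanSpace ℝ (Fin q))
      (w : EuclideanSpace ℝ (Fin t)), ‖u‖ = 1 → ‖v‖ = 1 → ‖w‖ = 1 → trilin X u v w ≤ c) :
    tensorNorm X ≤ c := by
  refine Real.sSup_le ?_ hc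
  rintro _ ⟨u, v, w, hu, hv, hw, rfl⟩
  exact h u v w hu hv hw

lemma trilin_le_of_unit {X : Tensor3 p q t} {c : ℝ}
    (h : ∀ (u : EuclideanSpace ℝ (Fin p)) (v : EuclideanSpace ℝ (Fin q))
      (w : EuclideanSpace ℝ (Fin t)), ‖u‖ = 1 → ‖v‖ = 1 → ‖w‖ = 1 → trilin X u v w ≤ c)
    (u : EuclideanSpace ℝ (Fin p)) (v : EuclideanSpace ℝ (Fin q))
    (w : EuclideanSpace ℝ (Fin t)) : trilin X u v w ≤ c * (‖u‖ * ‖v‖ * ‖w‖) := by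
  rcases eq_or_ne u 0 with rfl | hu
  · simp [trilin]
  rcases eq_or_ne v 0 with rfl | hv
  · simp [trilin]
  rcases eq_or_ne w 0 with rfl | hw
  · simp [trilin]
  have key := h (‖u‖⁻¹ • u) (‖v‖⁻¹ • v) (‖w‖⁻¹ • w) (norm_smul_inv_norm hu)
    (norm_smul_inv_norm hv) (norm_smul_inv_norm hw)
  have h1 : trilin X (‖u‖⁻¹ • u) (‖v‖⁻¹ • v) (‖w‖⁻¹ • w)
      = ‖u‖⁻¹ * (‖v‖⁻¹ * (‖w‖⁻¹ * trilin X u v w)) := by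
    have e1 := (isLinearMap_trilin_fst X (‖v‖⁻¹ • v) (‖w‖⁻¹ • w)).map_smul ‖u‖⁻¹ u
    have e2 := (isLinearMap_trilin_snd X u (‖w‖⁻¹ • w)).map_smul ‖v‖⁻¹ v
    have e3 := (isLinearMap_trilin_thd X u v).map_smul ‖w‖⁻¹ w
    simp only [smul_eq_mul] at e1 e2 e3
    rw [e1, e2, e3]
  have pu := norm_pos_iff.2 hu
  have pv := norm_pos_iff.2 hv
  have pw := norm_pos_iff.2 hw
  rw [h1] at key
  calc trilin X u v w = (‖u‖⁻¹ * (‖v‖⁻¹ * (‖w‖⁻¹ * trilin X u v w))) * (‖u‖ * ‖v‖ * ‖w‖) := by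
        field_simp
    _ ≤ _ := by gcongr

/-- Since `Y` is an admissible competitor, `Q` is at least as close to `X` as `Y` is; the triangle
inequality through `X` gives the factor 2. -/
lemma TensorMDP.IsBestTuckerApprox.trilin_sub_le {r l m : ℕ} {X Q Y : Tensor3 p q t}
    (hQ : IsBestTuckerApprox r l m X Q) (hY : TuckerRankLE Y r l m) {c : ℝ} (hc : 0 ≤ c)
    (h : ∀ (u : EuclideanSpace ℝ (Fin p)) (v : EuclideanSpace ℝ (Fin q))
      (w : EuclideanSpace ℝ (Fin t)), ‖u‖ = 1 → ‖v‖ = 1 → ‖w‖ = 1 → trilin (X - Y) u v w ≤ c)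
    (u : EuclideanSpace ℝ (Fin p)) (v : EuclideanSpace ℝ (Fin q))
    (w : EuclideanSpace ℝ (Fin t)) : trilin (Q - Y) u v w ≤ 2 * c * (‖u‖ * ‖v‖ * ‖w‖) := by
  refine trilin_le_of_unit (fun u v w hu hv hw => ?_) u v w
  have h1 : trilin (Q - X) u v w ≤ c := by
    refine (trilin_le_tensorNorm _ hu hv hw).trans ((hQ.2 Y hY).trans (tensorNorm_le hc ?_))
    intro u v w hu hv hw
    -- The hypothesis is one-sided; changing the sign of `u` turns it into a bound for Y − X.
    have := h (-u) v w (by rwa [norm_neg]) hv hw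
    rw [(isLinearMap_trilin_fst _ v w).map_neg, trilin_sub] at this
    rw [trilin_sub]
    linarith
  have h2 := h u v w hu hv hw
  rw [trilin_sub] at h1 h2 ⊢
  linarith

end Trilinear

/-! ### Operator norms and perturbation of inverses -/

section Matrices

variable {d : ℕ}

/-- The bilinear form of a matrix. -/
noncomputable def bilin (M : Matrix (Fin d) (Fin d) ℝ) (u v : EuclideanSpace ℝ (Fin d)) : ℝ :=
  ∑ i, ∑ j, M i j * (u i * v j)

lemma bilin_eq_inner (M : Matrix (Fin d) (Fin d) ℝ) (u v : EuclideanSpace ℝ (Fin d)) :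
    bilin M u v = inner ℝ u (Matrix.toEuclideanCLM (𝕜 := ℝ) M v) := by
  simp only [bilin, PiLp.inner_apply, Matrix.ofLp_toEuclideanCLM, Matrix.mulVec, dotProduct,
    RCLike.inner_apply, conj_trivial, Finset.sum_mul]
  exact Finset.sum_congr rfl fun i _ => Finset.sum_congr rfl fun j _ => by ring

lemma bilin_le_matNorm (M : Matrix (Fin d) (Fin d) ℝ) (u v : EuclideanSpace ℝ (Fin d)) :
    bilin M u v ≤ matNorm M * (‖u‖ * ‖v‖) := by
  rw [bilin_eq_inner]
  refine (real_inner_le_norm _ _).trans ?_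
  have := mul_le_mul_of_nonneg_left
    ((Matrix.toEuclideanCLM (𝕜 := ℝ) M).le_opNorm v) (norm_nonneg u)
  exact this.trans (le_of_eq (by rw [matNorm]; ring))

/-- Testing with `u = M v` gives ‖Mv‖² ≤ c‖Mv‖‖v‖. -/
lemma matNorm_le {M : Matrix (Fin d) (Fin d) ℝ} {c : ℝ} (hc : 0 ≤ c)
    (h : ∀ u v, bilin M u v ≤ c * (‖u‖ * ‖v‖)) : matNorm M ≤ c := by
  refine ContinuousLinearMap.opNorm_le_bound _ hc fun v => ?_
  set x := Matrix.toEuclideanCLM (𝕜 := ℝ) M v with hx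
  have h1 := h x v
  rw [bilin_eq_inner, ← hx, real_inner_self_eq_norm_sq] at h1
  rcases (norm_nonneg x).eq_or_lt with h0 | h0
  · rw [← h0]; positivity
  · nlinarith

lemma isLinearMap_bilin_fst (M : Matrix (Fin d) (Fin d) ℝ) (v : EuclideanSpace ℝ (Fin d)) :
    IsLinearMap ℝ fun u => bilin M u v where
  map_add u u' := by simp only [bilin_eq_inner, inner_add_left]
  map_smul c u := by simp only [bilin_eq_inner, real_inner_smul_left, smul_eq_mul]

lemma isLinearMap_bilin_snd (M : Matrix (Fin d) (Fin d) ℝ) (u : EuclideanSpace ℝ (Fin d)) :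
    IsLinearMap ℝ fun v => bilin M u v where
  map_add v v' := by simp only [bilin_eq_inner, map_add, inner_add_right]
  map_smul c v := by simp only [bilin_eq_inner, map_smul, real_inner_smul_right, smul_eq_mul]

lemma matNorm_le_of_net {N : Finset (EuclideanSpace ℝ (Fin d))}
    (hN : ∀ x : EuclideanSpace ℝ (Fin d), ‖x‖ = 1 → ∃ y ∈ N, ‖x - y‖ ≤ 1 / 2)
    {M : Matrix (Fin d) (Fin d) ℝ} {c : ℝ} (hc : 0 ≤ c)
    (h : ∀ u ∈ N, ∀ v ∈ N, bilin M u v ≤ c) : matNorm M ≤ 4 * c := by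
  refine matNorm_le (by positivity) fun u v => ?_
  have e1 : ∀ v ∈ N, ∀ u, bilin M u v ≤ 2 * c * ‖u‖ := fun v hv u =>
    linear_le_of_net hN (isLinearMap_bilin_fst M v) hc (fun u hu => h u hu v hv) u
  have e2 := linear_le_of_net hN (isLinearMap_bilin_snd M u) (c := 2 * c * ‖u‖) (by positivity)
    (fun v hv => e1 v hv u) v
  exact e2.trans (le_of_eq (by ring))

lemma matNorm_nonneg (M : Matrix (Fin d) (Fin d) ℝ) : 0 ≤ matNorm M := norm_nonneg _

lemma matNorm_mul_le (M M' : Matrix (Fin d) (Fin d) ℝ) :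
    matNorm (M * M') ≤ matNorm M * matNorm M' := by
  unfold matNorm
  rw [map_mul]
  exact norm_mul_le _ _

lemma matNorm_add_le (M M' : Matrix (Fin d) (Fin d) ℝ) :
    matNorm (M + M') ≤ matNorm M + matNorm M' := by
  unfold matNorm
  rw [map_add]
  exact norm_add_le _ _

lemma matNorm_neg (M : Matrix (Fin d) (Fin d) ℝ) : matNorm (-M) = matNorm M := by
  unfold matNorm
  rw [map_neg, norm_neg]

lemma matNorm_transpose (M : Matrix (Fin d) (Fin d) ℝ) : matNorm M.transpose = matNorm M := by
  have h : M.transpose = star M := by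
    ext i j; simp [Matrix.star_apply]
  unfold matNorm
  rw [h, map_star, ContinuousLinearMap.star_eq_adjoint, LinearIsometryEquiv.norm_map]

lemma one_le_matNorm_one [NeZero d] : 1 ≤ matNorm (1 : Matrix (Fin d) (Fin d) ℝ) := by
  unfold matNorm
  rw [map_one]
  exact le_of_eq norm_one.symm

/-- Neumann series: B = A(1 − A⁻¹(A − B)), and the subtracted term has norm below 1. -/
lemma isUnit_det_of_matNorm_sub_le {A B : Matrix (Fin d) (Fin d) ℝ} (hA : IsUnit A.det) {ε : ℝ}
    (hε : matNorm (B - A) ≤ ε) (hsmall : matNorm A⁻¹ * ε ≤ 1 / 2) : IsUnit B.det := by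
  have hB : B = A * (1 - A⁻¹ * (A - B)) := by
    rw [mul_sub, mul_one, ← mul_assoc, Matrix.mul_nonsing_inv _ hA, one_mul, sub_sub_cancel]
  have hlt : matNorm (A⁻¹ * (A - B)) < 1 := by
    have h1 := matNorm_mul_le A⁻¹ (A - B)
    have h2 : matNorm (A - B) ≤ ε := by rwa [← neg_sub, matNorm_neg]
    have := mul_le_mul_of_nonneg_left h2 (matNorm_nonneg A⁻¹)
    linarith
  have hu : IsUnit (1 - A⁻¹ * (A - B)) := by
    have := isUnit_one_sub_of_norm_lt_one hlt
    rw [← map_one (Matrix.toEuclideanCLM (𝕜 := ℝ) (n := Fin d)), ← map_sub] at this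
    exact (MulEquiv.isUnit_map (Matrix.toEuclideanCLM (𝕜 := ℝ) (n := Fin d))).1 this
  rw [hB, Matrix.det_mul]
  exact hA.mul ((Matrix.isUnit_iff_isUnit_det _).1 hu)

/-- From B⁻¹ − A⁻¹ = B⁻¹(A − B)A⁻¹ one gets ‖B⁻¹‖ ≤ ‖A⁻¹‖ + ‖B⁻¹‖/2. Absorbing the last term gives
the first bound, and reinserting it gives the second. -/
lemma matNorm_inv_le_of_matNorm_sub_le {A B : Matrix (Fin d) (Fin d) ℝ} (hA : IsUnit A.det)
    {ε : ℝ} (hε : matNorm (B - A) ≤ ε) (hsmall : matNorm A⁻¹ * ε ≤ 1 / 2) :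
    matNorm B⁻¹ ≤ 2 * matNorm A⁻¹ ∧ matNorm (B⁻¹ - A⁻¹) ≤ 2 * matNorm A⁻¹ ^ 2 * ε := by
  have hB := isUnit_det_of_matNorm_sub_le hA hε hsmall
  have hdiff : B⁻¹ - A⁻¹ = B⁻¹ * (A - B) * A⁻¹ := by
    rw [mul_sub, sub_mul, Matrix.nonsing_inv_mul _ hB, one_mul, mul_assoc,
      Matrix.mul_nonsing_inv _ hA, mul_one]
  have h2 : matNorm (A - B) ≤ ε := by rwa [← neg_sub, matNorm_neg]
  have h3 : matNorm (B⁻¹ - A⁻¹) ≤ matNorm B⁻¹ * ε * matNorm A⁻¹ := by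
    rw [hdiff]
    refine (matNorm_mul_le _ _).trans (mul_le_mul_of_nonneg_right ?_ (matNorm_nonneg _))
    exact (matNorm_mul_le _ _).trans (mul_le_mul_of_nonneg_left h2 (matNorm_nonneg _))
  have h4 : matNorm B⁻¹ ≤ matNorm (B⁻¹ - A⁻¹) + matNorm A⁻¹ := by
    have := matNorm_add_le (B⁻¹ - A⁻¹) A⁻¹
    rwa [sub_add_cancel] at this
  have h5 := matNorm_nonneg B⁻¹
  have h6 := matNorm_nonneg A⁻¹
  have h7 : matNorm B⁻¹ ≤ 2 * matNorm A⁻¹ := by nlinarith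
  have hε0 : 0 ≤ ε := (matNorm_nonneg _).trans hε
  refine ⟨h7, h3.trans ?_⟩
  have := mul_le_mul_of_nonneg_right (mul_le_mul_of_nonneg_right h7 hε0) h6
  linarith

end Matrices

/-! ### Mode products and the plug-in error -/

section ModeProduct

variable {p q t : ℕ}

lemma modeOne_mul (X : Tensor3 p q t) (U V : Matrix (Fin p) (Fin p) ℝ) :
    modeOne X (U * V) = modeOne (modeOne X V) U := by
  funext i j k
  simp only [modeOne, Matrix.mul_apply, Finset.mul_sum, Finset.sum_mul]
  rw [Finset.sum_comm]
  exact Finset.sum_congr rfl fun _ _ => Finset.sum_congr rfl fun _ _ => by ring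

lemma modeOne_one (X : Tensor3 p q t) : modeOne X 1 = X := by
  funext i j k
  simp [modeOne, Matrix.one_apply]

lemma modeOne_sub_left (X Y : Tensor3 p q t) (U : Matrix (Fin p) (Fin p) ℝ) :
    modeOne (X - Y) U = modeOne X U - modeOne Y U := by
  funext i j k
  simp [modeOne, sub_mul]

lemma modeOne_sub_right (X : Tensor3 p q t) (U V : Matrix (Fin p) (Fin p) ℝ) :
    modeOne X (U - V) = modeOne X U - modeOne X V := by
  funext i j k
  simp [modeOne, mul_sub]

lemma trilin_modeOne (X : Tensor3 p q t) (U : Matrix (Fin p) (Fin p) ℝ)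
    (u : EuclideanSpace ℝ (Fin p)) (v : EuclideanSpace ℝ (Fin q))
    (w : EuclideanSpace ℝ (Fin t)) : trilin (modeOne X U) u v w
      = trilin X (Matrix.toEuclideanCLM (𝕜 := ℝ) U.transpose u) v w := by
  simp only [trilin, modeOne, Matrix.ofLp_toEuclideanCLM, Matrix.mulVec, dotProduct,
    Matrix.transpose_apply, Finset.sum_mul, Finset.mul_sum]
  have h : ∀ f : Fin p → Fin q → Fin t → Fin p → ℝ,
      ∑ i, ∑ j, ∑ k, ∑ i', f i j k i' = ∑ j, ∑ k, ∑ i, ∑ i', f i j k i' := fun f => by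
    rw [Finset.sum_comm]
    exact Finset.sum_congr rfl fun _ _ => Finset.sum_comm
  rw [h, h]
  refine Finset.sum_congr rfl fun j _ => Finset.sum_congr rfl fun k _ => ?_
  rw [Finset.sum_comm]
  exact Finset.sum_congr rfl fun _ _ => Finset.sum_congr rfl fun _ _ => by ring

lemma trilin_modeOne_le {X : Tensor3 p q t} {c : ℝ} (hc : 0 ≤ c)
    (h : ∀ (u : EuclideanSpace ℝ (Fin p)) (v : EuclideanSpace ℝ (Fin q))
      (w : EuclideanSpace ℝ (Fin t)), trilin X u v w ≤ c * (‖u‖ * ‖v‖ * ‖w‖))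
    (U : Matrix (Fin p) (Fin p) ℝ)
    {u : EuclideanSpace ℝ (Fin p)} {v : EuclideanSpace ℝ (Fin q)}
    {w : EuclideanSpace ℝ (Fin t)} (hu : ‖u‖ = 1) (hv : ‖v‖ = 1) (hw : ‖w‖ = 1) :
    trilin (modeOne X U) u v w ≤ c * matNorm U := by
  rw [trilin_modeOne]
  refine (h _ v w).trans (mul_le_mul_of_nonneg_left ?_ hc)
  rw [hv, hw, mul_one, mul_one, ← matNorm_transpose]
  have := (Matrix.toEuclideanCLM (𝕜 := ℝ) U.transpose).le_opNorm u
  rwa [hu, mul_one] at this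

/-- The first flattening is multiplied on the left by `U`, the other two on the right by a matrix
acting as `U` on the first index and trivially on the other. -/
lemma tuckerRankLE_modeOne {X : Tensor3 p q t} {r l m : ℕ} (hX : TuckerRankLE X r l m)
    (U : Matrix (Fin p) (Fin p) ℝ) : TuckerRankLE (modeOne X U) r l m := by
  refine ⟨le_trans ?_ hX.1, le_trans ?_ hX.2.1, le_trans ?_ hX.2.2⟩
  · have : flatten1 (modeOne X U) = U * flatten1 X := by
      ext i jk
      simp only [flatten1, modeOne, Matrix.of_apply, Matrix.mul_apply]
      exact Finset.sum_congr rfl fun _ _ => mul_comm _ _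
    rw [this]
    exact Matrix.rank_mul_le_right _ _
  · have : flatten2 (modeOne X U) = flatten2 X *
        (Matrix.of fun (ik i'k' : Fin p × Fin t) => if ik.2 = i'k'.2 then U i'k'.1 ik.1 else 0) := by
      ext j ik
      rw [Matrix.mul_apply]
      simp [flatten2, modeOne, Fintype.sum_prod_type]
    rw [this]
    exact Matrix.rank_mul_le_left _ _
  · have : flatten3 (modeOne X U) = flatten3 X *
        (Matrix.of fun (ij i'j' : Fin p × Fin q) => if ij.2 = i'j'.2 then U i'j'.1 ij.1 else 0) := by
      ext k ij
      rw [Matrix.mul_apply]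
      simp [flatten3, modeOne, Fintype.sum_prod_type]
    rw [this]
    exact Matrix.rank_mul_le_left _ _

/-- The error of the plug-in estimator in terms of the errors of the mean embedding and of the
covariance. -/
lemma tensorNorm_plugin_sub_le {r l m : ℕ} {P X Q : Tensor3 p q t}
    {A B : Matrix (Fin p) (Fin p) ℝ} (hA : IsUnit A.det) {ε c Λ : ℝ} (hc : 0 ≤ c) (hΛ : 0 ≤ Λ)
    (hε : matNorm (B - A) ≤ ε) (hsmall : matNorm A⁻¹ * ε ≤ 1 / 2)
    (hQ : IsBestTuckerApprox r l m X Q) (hP : TuckerRankLE P r l m)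
    (hX : ∀ (u : EuclideanSpace ℝ (Fin p)) (v : EuclideanSpace ℝ (Fin q))
      (w : EuclideanSpace ℝ (Fin t)), ‖u‖ = 1 → ‖v‖ = 1 → ‖w‖ = 1 →
      trilin (X - modeOne P A) u v w ≤ c)
    (hF : ∀ (u : EuclideanSpace ℝ (Fin p)) (v : EuclideanSpace ℝ (Fin q))
      (w : EuclideanSpace ℝ (Fin t)), ‖u‖ = 1 → ‖v‖ = 1 → ‖w‖ = 1 →
      trilin (modeOne P A) u v w ≤ Λ) :
    tensorNorm (modeOne Q B⁻¹ - P) ≤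
      2 * c * (2 * matNorm A⁻¹) + Λ * (2 * matNorm A⁻¹ ^ 2 * ε) := by
  obtain ⟨h1, h2⟩ := matNorm_inv_le_of_matNorm_sub_le hA hε hsmall
  have hε0 : 0 ≤ ε := (matNorm_nonneg _).trans hε
  have hσ := matNorm_nonneg A⁻¹
  -- With F = P ×₁ A and P = F ×₁ A⁻¹, the term F ×₁ B⁻¹ is subtracted and added back.
  have hdec : modeOne Q B⁻¹ - P =
      modeOne (Q - modeOne P A) B⁻¹ - modeOne (modeOne P A) (A⁻¹ - B⁻¹) := by
    rw [modeOne_sub_left, modeOne_sub_right, ← modeOne_mul P A⁻¹ A, Matrix.nonsing_inv_mul _ hA,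
      modeOne_one]
    abel
  refine tensorNorm_le (by positivity) fun u v w hu hv hw => ?_
  have e1 := trilin_modeOne_le (by positivity)
    (IsBestTuckerApprox.trilin_sub_le hQ (tuckerRankLE_modeOne hP A) hc hX) B⁻¹ hu hv hw
  have e2 := trilin_modeOne_le hΛ (trilin_le_of_unit hF) (A⁻¹ - B⁻¹) (u := -u)
    (by rwa [norm_neg]) hv hw
  rw [(isLinearMap_trilin_fst _ v w).map_neg] at e2
  rw [show matNorm (A⁻¹ - B⁻¹) = matNorm (B⁻¹ - A⁻¹) by rw [← neg_sub, matNorm_neg]] at e2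
  rw [hdec, trilin_sub]
  have e3 := mul_le_mul_of_nonneg_left h1 (by positivity : 0 ≤ 2 * c)
  have e4 := mul_le_mul_of_nonneg_left h2 hΛ
  linarith

end ModeProduct

/-! ### Features of a reproducing kernel Hilbert space -/

section FeatureMaps

variable {X H : Type*} [NormedAddCommGroup H] [InnerProductSpace ℝ H] [RKHS ℝ H X ℝ] {d : ℕ}
  {φ : Fin d → H}

/-- The function `x ↦ uᵀφ(x)`. -/
noncomputable def featureForm (φ : Fin d → H) (u : EuclideanSpace ℝ (Fin d)) (x : X) : ℝ :=
  ∑ i, u i * φ i x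

lemma measurable_featureForm [MeasurableSpace X] (hφm : ∀ i, Measurable fun x => φ i x)
    (u : EuclideanSpace ℝ (Fin d)) : Measurable (featureForm (X := X) φ u) :=
  Finset.measurable_fun_sum _ fun i _ => (hφm i).const_mul _

variable [CompleteSpace H]

/-- The features span the kernel space. -/
lemma TensorMDP.IsFeatureMap.exists_eq_sum (hφ : IsFeatureMap (X := X) φ) (g : H) :
    ∃ α : Fin d → ℝ, ∀ x : X, g x = ∑ i, α i * φ i x := by
  -- Every kernel section lies in the span of the features. A vector orthogonal to that span
  -- therefore vanishes at every point, and the span, being finite-dimensional, is everything.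
  have hker : ∀ x : X, RKHS.kerFun H x (1 : ℝ) = ∑ i, φ i x • φ i := fun x => by
    refine RKHS.ext fun y => ?_
    rw [RKHS.kerFun_apply]
    refine (hφ y x).trans ?_
    rw [← RKHS.coeCLM_apply (𝕜 := ℝ) (∑ i, φ i x • φ i), map_sum, Finset.sum_apply]
    simp [mul_comm]
  have htop : Submodule.span ℝ (Set.range φ) = ⊤ := by
    have : FiniteDimensional ℝ (Submodule.span ℝ (Set.range φ)) :=
      FiniteDimensional.span_of_finite ℝ (Set.finite_range φ)
    rw [← Submodule.orthogonal_eq_bot_iff, Submodule.eq_bot_iff]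
    intro f hf
    refine RKHS.ext fun x => ?_
    have hmem : RKHS.kerFun H x (1 : ℝ) ∈ Submodule.span ℝ (Set.range φ) := by
      rw [hker]
      exact Submodule.sum_mem _ fun i _ => Submodule.smul_mem _ _ (Submodule.subset_span ⟨i, rfl⟩)
    have h0 : inner ℝ f (RKHS.kerFun H x (1 : ℝ)) = 0 :=
      (Submodule.mem_orthogonal' _ _).1 hf _ hmem
    rw [RKHS.inner_kerFun] at h0
    simpa using h0
  obtain ⟨α, hα⟩ := (Submodule.mem_span_range_iff_exists_fun ℝ).1 (htop ▸ Submodule.mem_top (x := g))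
  refine ⟨α, fun x => ?_⟩
  rw [← hα, ← RKHS.coeCLM_apply (𝕜 := ℝ) (∑ i, α i • φ i), map_sum, Finset.sum_apply]
  simp

lemma TensorMDP.IsFeatureMap.kernel_nonneg (hφ : IsFeatureMap (X := X) φ) (x : X) :
    0 ≤ scalarKernel H x x := by
  rw [hφ]
  exact Finset.sum_nonneg fun i _ => mul_self_nonneg _

lemma TensorMDP.IsFeatureMap.featureForm_sq_le (hφ : IsFeatureMap (X := X) φ)
    {u : EuclideanSpace ℝ (Fin d)} (hu : ‖u‖ = 1) (x : X) :
    featureForm φ u x ^ 2 ≤ scalarKernel H x x := by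
  have h := Finset.sum_mul_sq_le_sq_mul_sq Finset.univ (fun i => u i) (fun i => φ i x)
  have hu' : ∑ i, u i ^ 2 = 1 := by
    rw [← EuclideanSpace.real_norm_sq_eq, hu, one_pow]
  rw [hu', one_mul] at h
  rw [hφ]
  simpa only [featureForm, ← sq] using h

lemma TensorMDP.IsFeatureMap.apply_sq_le (hφ : IsFeatureMap (X := X) φ) (i : Fin d) (x : X) :
    φ i x ^ 2 ≤ scalarKernel H x x := by
  rw [hφ, sq]
  exact Finset.single_le_sum (f := fun i => φ i x * φ i x) (fun i _ => mul_self_nonneg _)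
    (Finset.mem_univ i)

variable {K : ℝ}

lemma TensorMDP.IsFeatureMap.abs_mul_le (hφ : IsFeatureMap (X := X) φ)
    (hK : ∀ s : X, scalarKernel H s s ≤ K) (i j : Fin d) (s : X) : |φ i s * φ j s| ≤ K := by
  have h1 := (hφ.apply_sq_le i s).trans (hK s)
  have h2 := (hφ.apply_sq_le j s).trans (hK s)
  rw [abs_le]
  constructor <;> nlinarith [sq_nonneg (φ i s - φ j s), sq_nonneg (φ i s + φ j s)]

lemma TensorMDP.IsFeatureMap.abs_featureForm_mul_le (hφ : IsFeatureMap (X := X) φ)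
    (hK : ∀ s : X, scalarKernel H s s ≤ K) {u v : EuclideanSpace ℝ (Fin d)} (hu : ‖u‖ = 1)
    (hv : ‖v‖ = 1) (s : X) : |featureForm φ u s * featureForm φ v s| ≤ K := by
  have h1 := (hφ.featureForm_sq_le hu s).trans (hK s)
  have h2 := (hφ.featureForm_sq_le hv s).trans (hK s)
  rw [abs_le]
  constructor <;> nlinarith [sq_nonneg (featureForm φ u s - featureForm φ v s),
    sq_nonneg (featureForm φ u s + featureForm φ v s)]

lemma TensorMDP.IsFeatureMap.abs_featureForm_le (hφ : IsFeatureMap (X := X) φ)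
    (hK : ∀ s : X, scalarKernel H s s ≤ K) {u : EuclideanSpace ℝ (Fin d)} (hu : ‖u‖ = 1)
    (s : X) : |featureForm φ u s| ≤ Real.sqrt K := by
  rw [← Real.sqrt_sq_eq_abs]
  exact Real.sqrt_le_sqrt ((hφ.featureForm_sq_le hu s).trans (hK s))

lemma TensorMDP.IsFeatureMap.abs_apply_le (hφ : IsFeatureMap (X := X) φ)
    (hK : ∀ s : X, scalarKernel H s s ≤ K) (i : Fin d) (s : X) : |φ i s| ≤ Real.sqrt K := by
  rw [← Real.sqrt_sq_eq_abs]
  exact Real.sqrt_le_sqrt ((hφ.apply_sq_le i s).trans (hK s))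

end FeatureMaps

/-! ### Existence, rank and uniqueness of the transition tensor -/

section TransitionTensor

variable {S A : Type*} [MeasurableSpace S] [MeasurableSpace A]
  {HS : Type*} [NormedAddCommGroup HS] [InnerProductSpace ℝ HS] [CompleteSpace HS] [RKHS ℝ HS S ℝ]
  {HA : Type*} [NormedAddCommGroup HA] [InnerProductSpace ℝ HA] [CompleteSpace HA] [RKHS ℝ HA A ℝ]
  {dS dA : ℕ} {φ : Fin dS → HS} {ψ : Fin dA → HA} {p : Kernel (S × A) S}

/-- The Tucker product of a core tensor with three factor matrices. -/
noncomputable def tuckerProduct {r l m p q t : ℕ} (c : Tensor3 r l m) (α : Fin r → Fin p → ℝ)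
    (β : Fin l → Fin q → ℝ) (γ : Fin m → Fin t → ℝ) : Tensor3 p q t :=
  fun i j k => ∑ i', ∑ j', ∑ k', c i' j' k' * α i' i * β j' j * γ k' k

/-- Each flattening factors through the corresponding dimension of the core. -/
lemma tuckerRankLE_tuckerProduct {r l m p q t : ℕ} (c : Tensor3 r l m) (α : Fin r → Fin p → ℝ)
    (β : Fin l → Fin q → ℝ) (γ : Fin m → Fin t → ℝ) :
    TuckerRankLE (tuckerProduct c α β γ) r l m := by
  refine ⟨?_, ?_, ?_⟩
  · have : flatten1 (tuckerProduct c α β γ) = (Matrix.of fun i i' => α i' i) *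
        (Matrix.of fun i' jk => ∑ j', ∑ k', c i' j' k' * β j' jk.1 * γ k' jk.2) := by
      ext i jk
      simp only [flatten1, tuckerProduct, Matrix.mul_apply, Matrix.of_apply, Finset.mul_sum]
      exact Finset.sum_congr rfl fun _ _ => Finset.sum_congr rfl fun _ _ =>
        Finset.sum_congr rfl fun _ _ => by ring
    rw [this]
    exact (Matrix.rank_mul_le_left _ _).trans (Matrix.rank_le_width _)
  · have : flatten2 (tuckerProduct c α β γ) = (Matrix.of fun j j' => β j' j) *
        (Matrix.of fun j' ik => ∑ i', ∑ k', c i' j' k' * α i' ik.1 * γ k' ik.2) := by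
      ext j ik
      simp only [flatten2, tuckerProduct, Matrix.mul_apply, Matrix.of_apply, Finset.mul_sum]
      rw [Finset.sum_comm]
      exact Finset.sum_congr rfl fun _ _ => Finset.sum_congr rfl fun _ _ =>
        Finset.sum_congr rfl fun _ _ => by ring
    rw [this]
    exact (Matrix.rank_mul_le_left _ _).trans (Matrix.rank_le_width _)
  · have : flatten3 (tuckerProduct c α β γ) = (Matrix.of fun k k' => γ k' k) *
        (Matrix.of fun k' ij => ∑ i', ∑ j', c i' j' k' * α i' ij.1 * β j' ij.2) := by
      ext k ij
      simp only [flatten3, tuckerProduct, Matrix.mul_apply, Matrix.of_apply, Finset.mul_sum]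
      symm
      rw [Finset.sum_comm]
      refine Finset.sum_congr rfl fun _ _ => ?_
      rw [Finset.sum_comm]
      exact Finset.sum_congr rfl fun _ _ => Finset.sum_congr rfl fun _ _ => by ring
    rw [this]
    exact (Matrix.rank_mul_le_left _ _).trans (Matrix.rank_le_width _)

/-- The core of the operator is kept. The first two factor matrices are feature coordinates of its
left factors, and the third consists of the inner products of the φ's with the `w`'s, so the rank
bound is immediate. -/
lemma exists_transitionTensor (hφ : IsFeatureMap (X := S) φ) (hψ : IsFeatureMap (X := A) ψ)
    {r l m : ℕ} (hp : LowRankTransition HS HA p r l m) :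
    ∃ P : Tensor3 dS dA dS, IsTransitionTensor p φ ψ P ∧ TuckerRankLE P r l m := by
  obtain ⟨c, u, v, w, h⟩ := hp.tucker
  choose α hα using fun i => hφ.exists_eq_sum (u i)
  choose β hβ using fun j => hψ.exists_eq_sum (v j)
  refine ⟨tuckerProduct c α β fun k' k => inner ℝ (φ k) (w k'), fun s a k => ?_,
    tuckerRankLE_tuckerProduct _ _ _ _⟩
  rw [h (φ k) s a]
  simp only [hα, hβ, tuckerProduct, Finset.sum_mul, Finset.mul_sum]
  have hswap : ∀ f : Fin dS → Fin dA → Fin r → Fin l → Fin m → ℝ,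
      ∑ i, ∑ j, ∑ i', ∑ j', ∑ k', f i j i' j' k' = ∑ i', ∑ j', ∑ k', ∑ j, ∑ i, f i j i' j' k' := by
    intro f
    have h1 : ∀ i, ∑ j, ∑ i', ∑ j', ∑ k', f i j i' j' k'
        = ∑ i', ∑ j', ∑ k', ∑ j, f i j i' j' k' := fun i => by
      rw [Finset.sum_comm]
      refine Finset.sum_congr rfl fun _ _ => ?_
      rw [Finset.sum_comm]
      exact Finset.sum_congr rfl fun _ _ => Finset.sum_comm
    simp only [h1]
    rw [Finset.sum_comm]
    refine Finset.sum_congr rfl fun _ _ => ?_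
    rw [Finset.sum_comm]
    refine Finset.sum_congr rfl fun _ _ => ?_
    rw [Finset.sum_comm]
    exact Finset.sum_congr rfl fun _ _ => Finset.sum_comm
  rw [hswap]
  refine Finset.sum_congr rfl fun _ _ => Finset.sum_congr rfl fun _ _ =>
    Finset.sum_congr rfl fun _ _ => Finset.sum_congr rfl fun _ _ =>
    Finset.sum_congr rfl fun _ _ => by ring

variable {K : ℝ}

/-- A linear relation among the features would be a null vector of their Gram matrix. -/
lemma coeff_eq_zero_of_covMatrix (hφ : IsFeatureMap (X := S) φ)
    (hφm : ∀ i, Measurable fun s => φ i s) (hKS : ∀ s : S, scalarKernel HS s s ≤ K)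
    {ξ : Measure S} [IsProbabilityMeasure ξ] (hcov : IsUnit (covMatrix φ ξ).det)
    {x : Fin dS → ℝ} (hx : ∀ s : S, ∑ i, x i * φ i s = 0) : x = 0 := by
  refine Matrix.eq_zero_of_mulVec_eq_zero hcov.ne_zero ?_
  funext i
  simp only [Matrix.mulVec, dotProduct, covMatrix, Matrix.of_apply, Pi.zero_apply,
    ← integral_mul_const]
  rw [← integral_finsetSum]
  · have : ∀ s : S, ∑ j, φ i s * φ j s * x j = 0 := fun s => by
      rw [← mul_zero (φ i s), ← hx s, Finset.mul_sum]
      exact Finset.sum_congr rfl fun _ _ => by ring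
    simp [this]
  · exact fun j _ => (integrable_of_abs_le ((hφm i).mul (hφm j))
      (hφ.abs_mul_le hKS i j)).mul_const _

lemma coeff_eq_zero_of_orthonormal (hψ : IsFeatureMap (X := A) ψ)
    (hψm : ∀ i, Measurable fun s => ψ i s) (hKA : ∀ a : A, scalarKernel HA a a ≤ K)
    {η : Measure A} [IsProbabilityMeasure η] (hψη : OrthonormalL2 ψ η)
    {x : Fin dA → ℝ} (hx : ∀ a : A, ∑ i, x i * ψ i a = 0) : x = 0 := by
  refine coeff_eq_zero_of_covMatrix hψ hψm hKA (ξ := η) ?_ hx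
  have : covMatrix ψ η = 1 := by
    ext i j
    simp [covMatrix, hψη i j, Matrix.one_apply]
  simp [this]

/-- The state features are linearly independent by invertibility of Σ, the action features by
orthonormality; the difference of two solutions is killed in one mode after the other. -/
lemma transitionTensor_unique (hφ : IsFeatureMap (X := S) φ) (hψ : IsFeatureMap (X := A) ψ)
    (hφm : ∀ i, Measurable fun s => φ i s) (hψm : ∀ j, Measurable fun a => ψ j a)
    (hKS : ∀ s : S, scalarKernel HS s s ≤ K) (hKA : ∀ a : A, scalarKernel HA a a ≤ K)
    {ξ : Measure S} [IsProbabilityMeasure ξ] (hcov : IsUnit (covMatrix φ ξ).det)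
    {η : Measure A} [IsProbabilityMeasure η] (hψη : OrthonormalL2 ψ η)
    {P P' : Tensor3 dS dA dS} (hP : IsTransitionTensor p φ ψ P)
    (hP' : IsTransitionTensor p φ ψ P') : P' = P := by
  have key : ∀ k : Fin dS, ∀ a : A, ∀ i, ∑ j, (P' i j k - P i j k) * ψ j a = 0 := fun k a => by
    have := coeff_eq_zero_of_covMatrix hφ hφm hKS hcov
      (x := fun i => ∑ j, (P' i j k - P i j k) * ψ j a) fun s => by
        have h := (hP' s a k).trans (hP s a k).symm
        rw [← sub_eq_zero, ← Finset.sum_sub_distrib] at h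
        rw [← h]
        refine Finset.sum_congr rfl fun i _ => ?_
        rw [← Finset.sum_sub_distrib, Finset.sum_mul]
        exact Finset.sum_congr rfl fun j _ => by ring
    exact fun i => congrFun this i
  funext i j k
  have := coeff_eq_zero_of_orthonormal hψ hψm hKA hψη (fun a => key k a i)
  exact sub_eq_zero.1 (congrFun this j)

end TransitionTensor

/-! ### Moments of the state features -/

section Covariance

variable {S : Type*} [MeasurableSpace S]
  {HS : Type*} [NormedAddCommGroup HS] [InnerProductSpace ℝ HS] [CompleteSpace HS] [RKHS ℝ HS S ℝ]
  {dS : ℕ} {φ : Fin dS → HS} {K : ℝ} {ξ : Measure S} [IsProbabilityMeasure ξ]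

/-- Weight 1 gives Σ, weight K_S(s, s) gives the matrix behind μ̄. -/
lemma bilin_weighted_covMatrix (hφ : IsFeatureMap (X := S) φ)
    (hφm : ∀ i, Measurable fun s => φ i s) (hKS : ∀ s : S, scalarKernel HS s s ≤ K)
    {g : S → ℝ} (hg : Measurable g) {C : ℝ} (hgC : ∀ s, |g s| ≤ C)
    (u v : EuclideanSpace ℝ (Fin dS)) :
    bilin (Matrix.of fun i j => ∫ s, g s * (φ i s * φ j s) ∂ξ) u v
      = ∫ s, g s * (featureForm φ u s * featureForm φ v s) ∂ξ := by
  have hint : ∀ i j, Integrable (fun s => g s * (φ i s * φ j s) * (u i * v j)) ξ := fun i j => by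
    refine (integrable_of_abs_le (hg.mul ((hφm i).mul (hφm j))) (C := C * K) fun s => ?_).mul_const _
    simp only [Pi.mul_apply, abs_mul (g s)]
    exact mul_le_mul (hgC s) (hφ.abs_mul_le hKS i j s) (abs_nonneg _)
      ((abs_nonneg _).trans (hgC s))
  simp only [bilin, Matrix.of_apply, ← integral_mul_const]
  simp only [← integral_finsetSum _ fun j _ => hint _ j]
  rw [← integral_finsetSum _ fun i _ => integrable_finsetSum _ fun j _ => hint i j]
  refine integral_congr_ae (ae_of_all _ fun s => ?_)
  simp only [featureForm]
  rw [Finset.sum_mul_sum, Finset.mul_sum]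
  refine Finset.sum_congr rfl fun _ _ => ?_
  rw [Finset.mul_sum]
  exact Finset.sum_congr rfl fun _ _ => by ring

lemma bilin_covMatrix (hφ : IsFeatureMap (X := S) φ)
    (hφm : ∀ i, Measurable fun s => φ i s) (hKS : ∀ s : S, scalarKernel HS s s ≤ K)
    (u v : EuclideanSpace ℝ (Fin dS)) :
    bilin (covMatrix φ ξ) u v = ∫ s, featureForm φ u s * featureForm φ v s ∂ξ := by
  have := bilin_weighted_covMatrix hφ hφm hKS (ξ := ξ) (g := fun _ => 1) measurable_const
    (C := 1) (by simp) u v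
  simpa [covMatrix] using this

/-- Cauchy–Schwarz bounds (uᵀφ(s))² by K_S(s, s), leaving the quadratic form of the weighted matrix
at `v`. -/
lemma integral_featureForm_sq_le_muBar (hφ : IsFeatureMap (X := S) φ)
    (hφm : ∀ i, Measurable fun s => φ i s) (hKS : ∀ s : S, scalarKernel HS s s ≤ K)
    {u v : EuclideanSpace ℝ (Fin dS)} (hu : ‖u‖ = 1) (hv : ‖v‖ = 1) :
    ∫ s, (featureForm φ u s * featureForm φ v s) ^ 2 ∂ξ ≤ muBar φ ξ := by
  have hKm : Measurable fun s : S => scalarKernel HS s s := by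
    simp only [hφ _ _]
    exact Finset.measurable_fun_sum _ fun i _ => (hφm i).mul (hφm i)
  have hKabs : ∀ s : S, |scalarKernel HS s s| ≤ K := fun s => by
    rw [abs_of_nonneg (hφ.kernel_nonneg s)]; exact hKS s
  have h1 := bilin_weighted_covMatrix hφ hφm hKS (ξ := ξ) hKm hKabs v v
  have h2 := bilin_le_matNorm
    (Matrix.of fun i j => ∫ s, scalarKernel HS s s * (φ i s * φ j s) ∂ξ) v v
  rw [h1, hv, mul_one, mul_one] at h2
  refine le_trans (integral_mono ?_ ?_ fun s => ?_) h2
  · refine integrable_of_abs_le (((measurable_featureForm hφm u).mul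
      (measurable_featureForm hφm v)).pow_const 2) (C := K ^ 2) fun s => ?_
    rw [abs_pow]
    exact pow_le_pow_left₀ (abs_nonneg _) (hφ.abs_featureForm_mul_le hKS hu hv s) 2
  · refine integrable_of_abs_le (hKm.mul ((measurable_featureForm hφm v).mul
      (measurable_featureForm hφm v))) (C := K * K) fun s => ?_
    rw [abs_mul]
    exact mul_le_mul (hKabs s) (hφ.abs_featureForm_mul_le hKS hv hv s) (abs_nonneg _)
      ((abs_nonneg _).trans (hKabs s))
  · show (featureForm φ u s * featureForm φ v s) ^ 2 ≤ _
    rw [mul_pow, ← sq]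
    exact mul_le_mul_of_nonneg_right (hφ.featureForm_sq_le hu s) (sq_nonneg _)

lemma sq_integral_le_integral_sq {X : Type*} [MeasurableSpace X] {μ : Measure X}
    [IsProbabilityMeasure μ] {f : X → ℝ} (hf : Measurable f) {C : ℝ} (hC : ∀ x, |f x| ≤ C) :
    (∫ x, f x ∂μ) ^ 2 ≤ ∫ x, f x ^ 2 ∂μ := by
  have hi : Integrable f μ := integrable_of_abs_le hf hC
  have h2i : Integrable (fun x => f x ^ 2) μ :=
    integrable_of_abs_le (hf.pow_const 2) (C := C ^ 2) fun x => by
      rw [abs_pow]; exact pow_le_pow_left₀ (abs_nonneg _) (hC x) 2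
  set m := ∫ x, f x ∂μ
  have h := integral_nonneg (μ := μ) (f := fun x => (f x - m) ^ 2) fun x => sq_nonneg _
  have heq : ∀ x, (f x - m) ^ 2 = f x ^ 2 - (2 * m * f x - m ^ 2) := fun x => by ring
  have hlin : Integrable (fun x => 2 * m * f x - m ^ 2) μ :=
    (hi.const_mul _).sub (integrable_const _)
  simp only [heq] at h
  rw [integral_sub h2i hlin, integral_sub (hi.const_mul _) (integrable_const _),
    integral_const_mul] at h
  simp only [integral_const, probReal_univ, smul_eq_mul, one_mul] at h
  nlinarith

/-- Jensen gives ‖Σ‖ ≤ √μ̄, while 1 ≤ ‖Σ⁻¹‖‖Σ‖. This makes μ̄ positive and lets the sample size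
condition force n/t_mix to be large in absolute terms. -/
lemma one_le_sq_matNorm_inv_mul_muBar [NeZero dS] (hφ : IsFeatureMap (X := S) φ)
    (hφm : ∀ i, Measurable fun s => φ i s) (hKS : ∀ s : S, scalarKernel HS s s ≤ K)
    (hcov : IsUnit (covMatrix φ ξ).det) :
    1 ≤ matNorm (covMatrix φ ξ)⁻¹ ^ 2 * muBar φ ξ := by
  have hmu0 : 0 ≤ muBar φ ξ := matNorm_nonneg _
  have hunit : ∀ u v : EuclideanSpace ℝ (Fin dS), ‖u‖ = 1 → ‖v‖ = 1 →
      bilin (covMatrix φ ξ) u v ≤ Real.sqrt (muBar φ ξ) := fun u v hu hv => by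
    rw [bilin_covMatrix hφ hφm hKS]
    refine Real.le_sqrt_of_sq_le (le_trans ?_ (integral_featureForm_sq_le_muBar hφ hφm hKS hu hv))
    exact sq_integral_le_integral_sq ((measurable_featureForm hφm u).mul
      (measurable_featureForm hφm v)) (hφ.abs_featureForm_mul_le hKS hu hv)
  have hnorm : matNorm (covMatrix φ ξ) ≤ Real.sqrt (muBar φ ξ) := by
    refine ContinuousLinearMap.opNorm_le_of_unit_norm (Real.sqrt_nonneg _) fun v hv => ?_
    set x := Matrix.toEuclideanCLM (𝕜 := ℝ) (covMatrix φ ξ) v with hx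
    rcases eq_or_ne x 0 with h0 | h0
    · rw [h0, norm_zero]; exact Real.sqrt_nonneg _
    · have := hunit (‖x‖⁻¹ • x) v (norm_smul_inv_norm h0) hv
      rw [bilin_eq_inner, ← hx, real_inner_smul_left, real_inner_self_eq_norm_sq] at this
      have hpos := norm_pos_iff.2 h0
      rwa [sq, ← mul_assoc, inv_mul_cancel₀ hpos.ne', one_mul] at this
  have h1 : 1 ≤ matNorm (covMatrix φ ξ)⁻¹ * Real.sqrt (muBar φ ξ) := by
    calc 1 ≤ matNorm ((covMatrix φ ξ)⁻¹ * covMatrix φ ξ) := by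
          rw [Matrix.nonsing_inv_mul _ hcov]; exact one_le_matNorm_one
      _ ≤ _ := (matNorm_mul_le _ _).trans (mul_le_mul_of_nonneg_left hnorm (matNorm_nonneg _))
  calc (1 : ℝ) ≤ (matNorm (covMatrix φ ξ)⁻¹ * Real.sqrt (muBar φ ξ)) ^ 2 := one_le_pow₀ h1
    _ = _ := by rw [mul_pow, Real.sq_sqrt hmu0]

end Covariance

/-! ### Change of measure from the behavior policy to η -/

section ImportanceWeights

variable {S A : Type*} {dens : S → A → ℝ≥0} {eta : A → ℝ≥0}

/-- The importance weight `η(a) / π(a | s)`. -/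
noncomputable def importanceWeight (eta : A → ℝ≥0) (dens : S → A → ℝ≥0) (z : (S × A) × S) : ℝ≥0 :=
  eta z.1.2 / dens z.1.1 z.1.2

/-- In `ℝ≥0∞` a nonzero number divided by zero is infinite, so finiteness of κ encodes absolute
continuity. -/
lemma eta_eq_zero_of_kappa_ne_top (hκ : kappa eta dens ≠ ⊤) {s : S} {a : A} (h : dens s a = 0) :
    eta a = 0 := by
  by_contra h0
  refine hκ (top_le_iff.1 ?_)
  have : (eta a : ℝ≥0∞) / (dens s a : ℝ≥0∞) ≤ kappa eta dens :=
    le_iSup_of_le s (le_iSup_of_le a le_rfl)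
  rwa [h, ENNReal.coe_zero, ENNReal.div_zero (by exact_mod_cast h0)] at this

/-- Where the policy density vanishes the weight is 0 by the convention for division in `ℝ≥0`. -/
lemma importanceWeight_le (hκ : kappa eta dens ≠ ⊤) (z : (S × A) × S) :
    (importanceWeight eta dens z : ℝ) ≤ (kappa eta dens).toReal := by
  unfold importanceWeight
  by_cases h : dens z.1.1 z.1.2 = 0
  · simp [h]
  · have : (eta z.1.2 : ℝ≥0∞) / (dens z.1.1 z.1.2 : ℝ≥0∞) ≤ kappa eta dens :=
      le_iSup_of_le z.1.1 (le_iSup_of_le z.1.2 le_rfl)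
    rw [← ENNReal.coe_div h] at this
    exact ENNReal.toReal_mono hκ this

variable [MeasurableSpace S] [MeasurableSpace A] {p : Kernel (S × A) S}
  [IsMarkovKernel p] {π : Kernel S A} [IsMarkovKernel π] {ξ : Measure S}

lemma lintegral_bind_stepKernel {g : (S × A) × S → ℝ≥0∞} (hg : Measurable g) :
    ∫⁻ z, g z ∂(ξ.bind (stepKernel p π))
      = ∫⁻ s, ∫⁻ a, ∫⁻ s', g ((s, a), s') ∂(p (s, a)) ∂(π s) ∂ξ := by
  rw [Measure.lintegral_bind (Kernel.aemeasurable _) hg.aemeasurable]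
  simp only [lintegral_stepKernel _ hg]

lemma map_bind_stepKernel : (ξ.bind (stepKernel p π)).map (fun z => z.1.1) = ξ := by
  ext B hB
  rw [← lintegral_indicator_one hB, lintegral_map' (by fun_prop) (by fun_prop),
    lintegral_bind_stepKernel (g := fun z => B.indicator 1 z.1.1)
      ((measurable_one.indicator hB).comp (by fun_prop))]
  simp [lintegral_indicator_one hB]

lemma integral_bind_stepKernel_fst {f : S → ℝ} (hf : Measurable f) :
    ∫ z, f z.1.1 ∂(ξ.bind (stepKernel p π)) = ∫ s, f s ∂ξ := by
  conv_rhs => rw [← map_bind_stepKernel (p := p) (π := π) (ξ := ξ)]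
  rw [integral_map (by fun_prop) hf.aestronglyMeasurable]

variable {refA : Measure A} {η : Measure A}

lemma measurable_importanceWeight (hdens : Measurable (Function.uncurry dens))
    (heta : Measurable eta) : Measurable (importanceWeight eta dens) :=
  (heta.comp (measurable_snd.comp measurable_fst)).div (hdens.comp measurable_fst)

variable [IsProbabilityMeasure ξ]

/-- Reweighting the actions turns the behavior policy into `η`. -/
lemma withDensity_importanceWeight (hdens : Measurable (Function.uncurry dens))
    (hπ : ∀ s, π s = refA.withDensity fun a => (dens s a : ℝ≥0∞)) [IsProbabilityMeasure η]
    (heta : Measurable eta) (hη : η = refA.withDensity fun a => (eta a : ℝ≥0∞))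
    (hκ : kappa eta dens ≠ ⊤) :
    (ξ.bind (stepKernel p π)).withDensity (fun z => (importanceWeight eta dens z : ℝ≥0∞))
      = (ξ.prod η) ⊗ₘ p := by
  ext B hB
  have hw := measurable_importanceWeight hdens heta
  have hB1 : Measurable (B.indicator (1 : (S × A) × S → ℝ≥0∞)) := measurable_one.indicator hB
  have hG : Measurable fun x : S × A => ∫⁻ s', B.indicator 1 (x, s') ∂(p x) :=
    hB1.lintegral_kernel_prod_right'
  rw [← lintegral_indicator_one hB, ← lintegral_indicator_one hB,
    lintegral_withDensity_eq_lintegral_mul _ hw.coe_nnreal_ennreal hB1,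
    lintegral_bind_stepKernel (hw.coe_nnreal_ennreal.mul hB1), Measure.lintegral_compProd hB1,
    lintegral_prod _ hG.aemeasurable]
  refine lintegral_congr fun s => ?_
  have hd : Measurable fun a => (dens s a : ℝ≥0∞) :=
    (hdens.comp measurable_prodMk_left).coe_nnreal_ennreal
  have hGs : Measurable fun a => ∫⁻ s', B.indicator 1 ((s, a), s') ∂(p (s, a)) :=
    hG.comp measurable_prodMk_left
  have hwa : ∀ (a : A), ∫⁻ s', ((fun z => (importanceWeight eta dens z : ℝ≥0∞)) *
      (B.indicator 1 : (S × A) × S → ℝ≥0∞)) ((s, a), s') ∂(p (s, a))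
      = ((eta a / dens s a : ℝ≥0) : ℝ≥0∞) * ∫⁻ s', B.indicator 1 ((s, a), s') ∂(p (s, a)) :=
    fun a => lintegral_const_mul (μ := p (s, a)) ((eta a / dens s a : ℝ≥0) : ℝ≥0∞)
      (f := fun s' => (B.indicator 1 : (S × A) × S → ℝ≥0∞) ((s, a), s'))
      (hB1.comp measurable_prodMk_left)
  simp only [hwa]
  have hwm : Measurable fun a => ((eta a / dens s a : ℝ≥0) : ℝ≥0∞) :=
    (heta.div (hdens.comp measurable_prodMk_left)).coe_nnreal_ennreal
  rw [hπ, hη]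
  refine ((lintegral_withDensity_eq_lintegral_mul refA hd (hwm.mul hGs)).trans ?_).trans
    (lintegral_withDensity_eq_lintegral_mul refA heta.coe_nnreal_ennreal hGs).symm
  refine lintegral_congr fun a => ?_
  simp only [Pi.mul_apply]
  rw [← mul_assoc, ← ENNReal.coe_mul]
  congr 2
  -- Weight 0 at a zero of the policy density loses no mass, because `eta` vanishes there too.
  by_cases h : dens s a = 0
  · rw [h, eta_eq_zero_of_kappa_ne_top hκ h]; simp
  · exact mul_div_cancel₀ _ h

end ImportanceWeights

/-- If κ were 0, `eta` would vanish identically and η would have no mass. -/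
lemma kappa_toReal_pos {S A : Type*} [MeasurableSpace A] {dens : S → A → ℝ≥0} {eta : A → ℝ≥0}
    {refA η : Measure A} [IsProbabilityMeasure η] (hη : η = refA.withDensity fun a => (eta a : ℝ≥0∞))
    (hκ : kappa eta dens ≠ ⊤) [Nonempty S] : 0 < (kappa eta dens).toReal := by
  refine lt_of_le_of_ne ENNReal.toReal_nonneg fun h0 => ?_
  have hzero : ∀ a, eta a = 0 := fun a => by
    obtain ⟨s⟩ := ‹Nonempty S›
    by_cases h : dens s a = 0
    · exact eta_eq_zero_of_kappa_ne_top hκ h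
    · have h1 := importanceWeight_le hκ ((s, a), s)
      rw [← h0] at h1
      have h2 : importanceWeight eta dens ((s, a), s) = 0 := le_antisymm (by exact_mod_cast h1) zero_le
      exact (div_eq_zero_iff.1 h2).resolve_right h
  have : η Set.univ = 0 := by simp [hη, hzero]
  simp at this

/-! ### Mean and second moment of the embedding -/

section Moments

variable {S A : Type*}
  {HS : Type*} [NormedAddCommGroup HS] [InnerProductSpace ℝ HS] [RKHS ℝ HS S ℝ]
  {HA : Type*} [NormedAddCommGroup HA] [InnerProductSpace ℝ HA] [RKHS ℝ HA A ℝ]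
  {dS dA : ℕ} {φ : Fin dS → HS} {ψ : Fin dA → HA}

/-- The function `(s, a, s') ↦ (uᵀφ(s)) (vᵀψ(a)) (wᵀφ(s'))`. -/
noncomputable def tripleForm (φ : Fin dS → HS) (ψ : Fin dA → HA) (u : EuclideanSpace ℝ (Fin dS))
    (v : EuclideanSpace ℝ (Fin dA)) (w : EuclideanSpace ℝ (Fin dS)) (z : (S × A) × S) : ℝ :=
  featureForm φ u z.1.1 * featureForm ψ v z.1.2 * featureForm φ w z.2

lemma tripleForm_eq_sum (u : EuclideanSpace ℝ (Fin dS)) (v : EuclideanSpace ℝ (Fin dA))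
    (w : EuclideanSpace ℝ (Fin dS)) (z : (S × A) × S) : tripleForm φ ψ u v w z =
      ∑ i, ∑ j, ∑ k, (φ i z.1.1 * ψ j z.1.2 * φ k z.2) * (u i * v j * w k) := by
  simp only [tripleForm, featureForm]
  rw [Finset.sum_mul_sum, Finset.sum_mul]
  refine Finset.sum_congr rfl fun _ _ => ?_
  rw [Finset.sum_mul]
  refine Finset.sum_congr rfl fun _ _ => ?_
  rw [Finset.mul_sum]
  exact Finset.sum_congr rfl fun _ _ => by ring

lemma trilin_meanEmbedding {n : ℕ} (eta : A → ℝ≥0) (dens : S → A → ℝ≥0) (s : Fin (n + 1) → S)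
    (a : Fin n → A) (u : EuclideanSpace ℝ (Fin dS)) (v : EuclideanSpace ℝ (Fin dA))
    (w : EuclideanSpace ℝ (Fin dS)) :
    trilin (meanEmbedding φ ψ eta dens s a) u v w = (n : ℝ)⁻¹ * ∑ x : Fin n,
      (importanceWeight eta dens ((s x.castSucc, a x), s x.succ) : ℝ) *
        tripleForm φ ψ u v w ((s x.castSucc, a x), s x.succ) := by
  simp only [trilin, meanEmbedding, tripleForm_eq_sum, Finset.mul_sum, Finset.sum_mul]
  have hswap : ∀ f : Fin dS → Fin dA → Fin dS → Fin n → ℝ,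
      ∑ i, ∑ j, ∑ k, ∑ x, f i j k x = ∑ x, ∑ i, ∑ j, ∑ k, f i j k x := fun f => by
    symm
    rw [Finset.sum_comm]
    refine Finset.sum_congr rfl fun _ _ => ?_
    rw [Finset.sum_comm]
    exact Finset.sum_congr rfl fun _ _ => Finset.sum_comm
  rw [hswap]
  refine Finset.sum_congr rfl fun _ _ => Finset.sum_congr rfl fun _ _ =>
    Finset.sum_congr rfl fun _ _ => Finset.sum_congr rfl fun _ _ => ?_
  simp only [importanceWeight, NNReal.coe_div]
  ring

lemma bilin_empCov {n : ℕ} (s : Fin (n + 1) → S) (u v : EuclideanSpace ℝ (Fin dS)) :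
    bilin (empCov φ s) u v = (n : ℝ)⁻¹ * ∑ x : Fin n,
      featureForm φ u (s x.castSucc) * featureForm φ v (s x.castSucc) := by
  simp only [bilin, empCov, featureForm, Matrix.of_apply, Finset.mul_sum, Finset.sum_mul]
  rw [Finset.sum_comm]
  symm
  rw [Finset.sum_comm]
  refine Finset.sum_congr rfl fun _ _ => ?_
  rw [Finset.sum_comm]
  exact Finset.sum_congr rfl fun _ _ => Finset.sum_congr rfl fun _ _ => by ring

lemma abs_tripleForm_le [CompleteSpace HS] [CompleteSpace HA] {K : ℝ}
    (hφ : IsFeatureMap (X := S) φ) (hψ : IsFeatureMap (X := A) ψ)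
    (hKS : ∀ s : S, scalarKernel HS s s ≤ K) (hKA : ∀ a : A, scalarKernel HA a a ≤ K)
    {u : EuclideanSpace ℝ (Fin dS)} {v : EuclideanSpace ℝ (Fin dA)}
    {w : EuclideanSpace ℝ (Fin dS)} (hu : ‖u‖ = 1) (hv : ‖v‖ = 1) (hw : ‖w‖ = 1)
    (z : (S × A) × S) : |tripleForm φ ψ u v w z| ≤ Real.sqrt K ^ 3 := by
  rw [tripleForm, abs_mul, abs_mul, pow_succ, sq]
  have hs := Real.sqrt_nonneg K
  exact mul_le_mul (mul_le_mul (hφ.abs_featureForm_le hKS hu _) (hψ.abs_featureForm_le hKA hv _)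
    (abs_nonneg _) hs) (hφ.abs_featureForm_le hKS hw _) (abs_nonneg _) (by positivity)

variable [MeasurableSpace S] [MeasurableSpace A]

lemma measurable_tripleForm (hφm : ∀ i, Measurable fun s => φ i s)
    (hψm : ∀ j, Measurable fun a => ψ j a) (u : EuclideanSpace ℝ (Fin dS))
    (v : EuclideanSpace ℝ (Fin dA)) (w : EuclideanSpace ℝ (Fin dS)) :
    Measurable (tripleForm φ ψ u v w) :=
  (((measurable_featureForm hφm u).comp (measurable_fst.comp measurable_fst)).mul
    ((measurable_featureForm hψm v).comp (measurable_snd.comp measurable_fst))).mul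
    ((measurable_featureForm hφm w).comp measurable_snd)

variable [CompleteSpace HS] [CompleteSpace HA] {K : ℝ}

variable {p : Kernel (S × A) S} [IsMarkovKernel p] {ξ : Measure S} [IsProbabilityMeasure ξ]
  {η : Measure A} [IsProbabilityMeasure η]

/-- Integrating out s' replaces φ(s') by the contraction of `P` with φ(s) and ψ(a). The product
structure of ξ ⊗ η then yields Σ in the first mode and, by orthonormality, the identity in the
second. -/
lemma modeOne_covMatrix_apply (hφ : IsFeatureMap (X := S) φ) (hψ : IsFeatureMap (X := A) ψ)
    (hφm : ∀ i, Measurable fun s => φ i s) (hψm : ∀ j, Measurable fun a => ψ j a)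
    (hKS : ∀ s : S, scalarKernel HS s s ≤ K) (hKA : ∀ a : A, scalarKernel HA a a ≤ K)
    (hψη : OrthonormalL2 ψ η) {P : Tensor3 dS dA dS} (hP : IsTransitionTensor p φ ψ P)
    (i : Fin dS) (j : Fin dA) (k : Fin dS) :
    modeOne P (covMatrix φ ξ) i j k
      = ∫ z, φ i z.1.1 * ψ j z.1.2 * φ k z.2 ∂((ξ.prod η) ⊗ₘ p) := by
  have hint : Integrable (fun z : (S × A) × S => φ i z.1.1 * ψ j z.1.2 * φ k z.2)
      ((ξ.prod η) ⊗ₘ p) := by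
    refine integrable_of_abs_le (C := Real.sqrt K * Real.sqrt K * Real.sqrt K) ?_ fun z => ?_
    · exact (((hφm i).comp (measurable_fst.comp measurable_fst)).mul
        ((hψm j).comp (measurable_snd.comp measurable_fst))).mul ((hφm k).comp measurable_snd)
    · rw [abs_mul, abs_mul]
      have hs := Real.sqrt_nonneg K
      exact mul_le_mul (mul_le_mul (hφ.abs_apply_le hKS i _) (hψ.abs_apply_le hKA j _)
        (abs_nonneg _) hs) (hφ.abs_apply_le hKS k _) (abs_nonneg _) (by positivity)
  have hprod : ∀ i' j', Integrable (fun x : S × A => P i' j' k *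
      ((φ i x.1 * φ i' x.1) * (ψ j x.2 * ψ j' x.2))) (ξ.prod η) := fun i' j' =>
    (Integrable.mul_prod (f := fun s : S => φ i s * φ i' s) (g := fun a : A => ψ j a * ψ j' a)
      (integrable_of_abs_le ((hφm i).mul (hφm i')) (hφ.abs_mul_le hKS i i'))
      (integrable_of_abs_le ((hψm j).mul (hψm j')) (hψ.abs_mul_le hKA j j'))).const_mul _
  rw [Measure.integral_compProd hint]
  have hinner : ∀ x : S × A, ∫ s', φ i x.1 * ψ j x.2 * φ k s' ∂(p x)
      = ∑ i', ∑ j', P i' j' k * ((φ i x.1 * φ i' x.1) * (ψ j x.2 * ψ j' x.2)) := fun x => by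
    rw [integral_const_mul]
    have := hP x.1 x.2 k
    rw [transitionOp] at this
    rw [← this, Finset.mul_sum]
    refine Finset.sum_congr rfl fun _ _ => ?_
    rw [Finset.mul_sum]
    exact Finset.sum_congr rfl fun _ _ => by ring
  simp only [hinner]
  rw [integral_finsetSum _ fun i' _ => integrable_finsetSum _ fun j' _ => hprod i' j']
  simp only [integral_finsetSum _ fun j' _ => hprod _ j', integral_const_mul]
  have hmul : ∀ i' j', ∫ x : S × A, (φ i x.1 * φ i' x.1) * (ψ j x.2 * ψ j' x.2) ∂(ξ.prod η)
      = covMatrix φ ξ i i' * if j = j' then 1 else 0 := fun i' j' => by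
    rw [← hψη j j', covMatrix, Matrix.of_apply]
    exact integral_prod_mul (fun s : S => φ i s * φ i' s) (fun a : A => ψ j a * ψ j' a)
  simp [hmul, modeOne]

lemma trilin_modeOne_covMatrix (hφ : IsFeatureMap (X := S) φ) (hψ : IsFeatureMap (X := A) ψ)
    (hφm : ∀ i, Measurable fun s => φ i s) (hψm : ∀ j, Measurable fun a => ψ j a)
    (hKS : ∀ s : S, scalarKernel HS s s ≤ K) (hKA : ∀ a : A, scalarKernel HA a a ≤ K)
    (hψη : OrthonormalL2 ψ η) {P : Tensor3 dS dA dS} (hP : IsTransitionTensor p φ ψ P)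
    (u : EuclideanSpace ℝ (Fin dS)) (v : EuclideanSpace ℝ (Fin dA))
    (w : EuclideanSpace ℝ (Fin dS)) :
    trilin (modeOne P (covMatrix φ ξ)) u v w = ∫ z, tripleForm φ ψ u v w z ∂((ξ.prod η) ⊗ₘ p) := by
  have hint : ∀ i j k, Integrable (fun z : (S × A) × S =>
      φ i z.1.1 * ψ j z.1.2 * φ k z.2 * (u i * v j * w k)) ((ξ.prod η) ⊗ₘ p) := fun i j k => by
    refine (integrable_of_abs_le (C := Real.sqrt K * Real.sqrt K * Real.sqrt K) ?_
      fun z => ?_).mul_const _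
    · exact (((hφm i).comp (measurable_fst.comp measurable_fst)).mul
        ((hψm j).comp (measurable_snd.comp measurable_fst))).mul ((hφm k).comp measurable_snd)
    · simp only [abs_mul]
      have hs := Real.sqrt_nonneg K
      exact mul_le_mul (mul_le_mul (hφ.abs_apply_le hKS i _) (hψ.abs_apply_le hKA j _)
        (abs_nonneg _) hs) (hφ.abs_apply_le hKS k _) (abs_nonneg _) (by positivity)
  simp only [trilin, tripleForm_eq_sum,
    modeOne_covMatrix_apply hφ hψ hφm hψm hKS hKA hψη hP, ← integral_mul_const]
  rw [integral_finsetSum _ fun i _ => integrable_finsetSum _ fun j _ =>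
    integrable_finsetSum _ fun k _ => hint i j k]
  refine Finset.sum_congr rfl fun i _ => ?_
  rw [integral_finsetSum _ fun j _ => integrable_finsetSum _ fun k _ => hint i j k]
  refine Finset.sum_congr rfl fun j _ => ?_
  rw [integral_finsetSum _ fun k _ => hint i j k]

lemma integral_tripleForm_sq_le_lambdaBar (hφ : IsFeatureMap (X := S) φ)
    (hψ : IsFeatureMap (X := A) ψ) (hKS : ∀ s : S, scalarKernel HS s s ≤ K)
    (hKA : ∀ a : A, scalarKernel HA a a ≤ K)
    {u : EuclideanSpace ℝ (Fin dS)} {v : EuclideanSpace ℝ (Fin dA)}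
    {w : EuclideanSpace ℝ (Fin dS)} (hu : ‖u‖ = 1) (hv : ‖v‖ = 1) (hw : ‖w‖ = 1) :
    ∫ z, tripleForm φ ψ u v w z ^ 2 ∂((ξ.prod η) ⊗ₘ p) ≤ lambdaBar p φ ψ ξ η := by
  refine le_csSup ⟨(Real.sqrt K ^ 3) ^ 2, ?_⟩ ⟨u, v, w, hu, hv, hw, rfl⟩
  rintro _ ⟨u, v, w, hu, hv, hw, rfl⟩
  have := norm_integral_le_of_norm_le_const (μ := (ξ.prod η) ⊗ₘ p)
    (f := fun z => tripleForm φ ψ u v w z ^ 2) (C := (Real.sqrt K ^ 3) ^ 2)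
    (ae_of_all _ fun z => by
      rw [Real.norm_eq_abs, abs_pow]
      exact pow_le_pow_left₀ (abs_nonneg _) (abs_tripleForm_le hφ hψ hKS hKA hu hv hw z) 2)
  rw [probReal_univ, mul_one] at this
  exact (le_abs_self _).trans this

lemma trilin_modeOne_covMatrix_le (hφ : IsFeatureMap (X := S) φ) (hψ : IsFeatureMap (X := A) ψ)
    (hφm : ∀ i, Measurable fun s => φ i s) (hψm : ∀ j, Measurable fun a => ψ j a)
    (hKS : ∀ s : S, scalarKernel HS s s ≤ K) (hKA : ∀ a : A, scalarKernel HA a a ≤ K)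
    (hψη : OrthonormalL2 ψ η) {P : Tensor3 dS dA dS} (hP : IsTransitionTensor p φ ψ P)
    {u : EuclideanSpace ℝ (Fin dS)} {v : EuclideanSpace ℝ (Fin dA)}
    {w : EuclideanSpace ℝ (Fin dS)} (hu : ‖u‖ = 1) (hv : ‖v‖ = 1) (hw : ‖w‖ = 1) :
    trilin (modeOne P (covMatrix φ ξ)) u v w ≤ Real.sqrt (lambdaBar p φ ψ ξ η) := by
  rw [trilin_modeOne_covMatrix hφ hψ hφm hψm hKS hKA hψη hP]
  refine Real.le_sqrt_of_sq_le (le_trans ?_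
    (integral_tripleForm_sq_le_lambdaBar hφ hψ hKS hKA hu hv hw))
  exact sq_integral_le_integral_sq (measurable_tripleForm hφm hψm u v w)
    (abs_tripleForm_le hφ hψ hKS hKA hu hv hw)

variable {π : Kernel S A} [IsMarkovKernel π] {refA : Measure A} {dens : S → A → ℝ≥0}
  {eta : A → ℝ≥0}

lemma integral_importanceWeight_mul (hdens : Measurable (Function.uncurry dens))
    (hπ : ∀ s, π s = refA.withDensity fun a => (dens s a : ℝ≥0∞))
    (heta : Measurable eta) (hη : η = refA.withDensity fun a => (eta a : ℝ≥0∞))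
    (hκ : kappa eta dens ≠ ⊤) (f : (S × A) × S → ℝ) :
    ∫ z, (importanceWeight eta dens z : ℝ) * f z ∂(ξ.bind (stepKernel p π))
      = ∫ z, f z ∂((ξ.prod η) ⊗ₘ p) := by
  rw [← withDensity_importanceWeight hdens hπ heta hη hκ,
    integral_withDensity_eq_integral_smul (measurable_importanceWeight hdens heta)]
  rfl

/-- One of the two weights performs the change of measure and the other is bounded by κ, so the
bound is linear in κ, not quadratic. -/
lemma integral_importanceWeight_mul_sq_le (hφ : IsFeatureMap (X := S) φ)
    (hψ : IsFeatureMap (X := A) ψ)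
    (hφm : ∀ i, Measurable fun s => φ i s) (hψm : ∀ j, Measurable fun a => ψ j a)
    (hKS : ∀ s : S, scalarKernel HS s s ≤ K) (hKA : ∀ a : A, scalarKernel HA a a ≤ K)
    (hdens : Measurable (Function.uncurry dens))
    (hπ : ∀ s, π s = refA.withDensity fun a => (dens s a : ℝ≥0∞))
    (heta : Measurable eta) (hη : η = refA.withDensity fun a => (eta a : ℝ≥0∞))
    (hκ : kappa eta dens ≠ ⊤)
    {u : EuclideanSpace ℝ (Fin dS)} {v : EuclideanSpace ℝ (Fin dA)}
    {w : EuclideanSpace ℝ (Fin dS)} (hu : ‖u‖ = 1) (hv : ‖v‖ = 1) (hw : ‖w‖ = 1) :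
    ∫ z, ((importanceWeight eta dens z : ℝ) * tripleForm φ ψ u v w z) ^ 2
        ∂(ξ.bind (stepKernel p π)) ≤ (kappa eta dens).toReal * lambdaBar p φ ψ ξ η := by
  have h1 : ∀ z : (S × A) × S, ((importanceWeight eta dens z : ℝ) * tripleForm φ ψ u v w z) ^ 2
      = importanceWeight eta dens z *
        (importanceWeight eta dens z * tripleForm φ ψ u v w z ^ 2) := fun z => by ring
  simp only [h1]
  rw [integral_importanceWeight_mul hdens hπ heta hη hκ]
  have hY2 : Integrable (fun z => tripleForm φ ψ u v w z ^ 2) ((ξ.prod η) ⊗ₘ p) :=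
    integrable_of_abs_le ((measurable_tripleForm hφm hψm u v w).pow_const 2)
      (C := (Real.sqrt K ^ 3) ^ 2) fun z => by
        rw [abs_pow]
        exact pow_le_pow_left₀ (abs_nonneg _) (abs_tripleForm_le hφ hψ hKS hKA hu hv hw z) 2
  refine le_trans (integral_mono_of_nonneg (ae_of_all _ fun z => ?_)
    (hY2.const_mul (kappa eta dens).toReal) (ae_of_all _ fun z => ?_)) ?_
  · exact mul_nonneg (NNReal.coe_nonneg _) (sq_nonneg _)
  · exact mul_le_mul_of_nonneg_right (importanceWeight_le hκ z) (sq_nonneg _)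
  · rw [integral_const_mul]
    exact mul_le_mul_of_nonneg_left
      (integral_tripleForm_sq_le_lambdaBar hφ hψ hKS hKA hu hv hw) ENNReal.toReal_nonneg

end Moments

/-! ### Numerical choices and constants -/

section Parameters

lemma mul_log_two_le_log {k : ℕ} {N : ℝ} (h : (2 : ℝ) ^ k ≤ N) : k * 0.69 ≤ Real.log N := by
  have h1 := Real.log_le_log (by positivity) h
  rw [Real.log_pow] at h1
  have h2 := Real.log_two_gt_d9
  have : (k : ℝ) * 0.69 ≤ k * Real.log 2 :=
    mul_le_mul_of_nonneg_left (by linarith) (Nat.cast_nonneg k)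
  linarith

/-- Bootstrapping N ≥ 8192 (log N)²: from log N ≥ 0.69 follows N ≥ 2¹¹, hence log N ≥ 7.59, hence N
≥ 2¹⁸, hence log N ≥ 12.42. -/
lemma ten_le_log {N : ℝ} (hN : 2 ≤ N) (h : 8192 ≤ N / Real.log N ^ 2) : 10 ≤ Real.log N := by
  have h1 : 0.69 ≤ Real.log N := by simpa using mul_log_two_le_log (k := 1) (by simpa using hN)
  have hpos : 0 < Real.log N ^ 2 := by positivity
  rw [le_div_iff₀ hpos] at h
  have h2 : (2 : ℝ) ^ 11 ≤ N := by nlinarith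
  have h3 := mul_log_two_le_log h2
  norm_num at h3
  have h4 : (2 : ℝ) ^ 18 ≤ N := by nlinarith
  have h5 := mul_log_two_le_log h4
  norm_num at h5
  linarith

/-- The exponent of the Bernstein bound for a suitable choice of its parameters. -/
lemma bernstein_exponent_le {T n : ℕ} (hT : 1 ≤ T) {N : ℝ} (hN : N = (n : ℝ) / T) (hN2 : 2 ≤ N)
    (hlog : 10 ≤ Real.log N) {v b Q Q' : ℝ} (hv : 0 < v) (hb : 0 ≤ b) (hQ : 1 ≤ Q) (hQQ' : Q ≤ Q')
    (h : 1024 * (b ^ 2 / v) * Q' ≤ N / Real.log N ^ 2) :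
    ∃ (θ : ℝ) (M : ℕ), 0 ≤ θ ∧ θ * (2 * b) ≤ 1 ∧
      θ * (2 * b) + (n : ℝ) / ((T * (M + 1) : ℕ) : ℝ) * (θ ^ 2 * v + 4 * (θ * (2 * b)) / 2 ^ M
        - θ * (4 * Real.sqrt (v * Q * (Real.log N ^ 2 / N)))) ≤ -(4 * Q) := by
  set l := Real.log N with hl
  have hN0 : 0 < N := by linarith
  set e := 4 * Real.sqrt (v * Q * (l ^ 2 / N)) with he
  have he0 : 0 ≤ e := by positivity
  have he2 : e ^ 2 = 16 * (v * Q * (l ^ 2 / N)) := by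
    rw [he, mul_pow, Real.sq_sqrt (by positivity)]; norm_num
  -- Half the minimizer e/(2v) of θ²v − θe; the gain is still 3e²/(16v), and the constant 1024 gives
  -- θb ≤ 1/32.
  set θ := e / (4 * v) with hθ
  have hθ0 : 0 ≤ θ := by positivity
  have hθb : θ * b ≤ 1 / 32 := by
    refine le_of_sq_le_sq ?_ (by norm_num)
    have h1 : (θ * b) ^ 2 = Q * (l ^ 2 / N) * (b ^ 2 / v) := by
      rw [mul_pow, hθ, div_pow, he2]; field_simp; ring
    have h2 : Q * (b ^ 2 / v) ≤ N / l ^ 2 / 1024 := by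
      have : Q * (b ^ 2 / v) ≤ Q' * (b ^ 2 / v) := mul_le_mul_of_nonneg_right hQQ' (by positivity)
      linarith
    rw [h1]
    calc Q * (l ^ 2 / N) * (b ^ 2 / v) = (Q * (b ^ 2 / v)) * (l ^ 2 / N) := by ring
      _ ≤ N / l ^ 2 / 1024 * (l ^ 2 / N) := mul_le_mul_of_nonneg_right h2 (by positivity)
      _ = (1 / 32) ^ 2 := by field_simp; norm_num
  -- Since 2 log 2 > 1, this gives 2ᴹ ≥ N, so the bias stays bounded after multiplication by N.
  set M := ⌈2 * l⌉₊ with hM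
  have hM1 : 2 * l ≤ M := Nat.le_ceil _
  have hM2 : (M : ℝ) < 2 * l + 1 := Nat.ceil_lt_add_one (by linarith)
  have h2M : N ≤ 2 ^ M := by
    rw [← Real.exp_log hN0, ← hl, ← Real.exp_log (show (0 : ℝ) < 2 ^ M by positivity),
      Real.log_pow]
    refine Real.exp_le_exp.2 ?_
    have := Real.log_two_gt_d9
    nlinarith
  refine ⟨θ, M, hθ0, by linarith, ?_⟩
  have hT0 : (0 : ℝ) < T := by exact_mod_cast hT
  have hn : (n : ℝ) / ((T * (M + 1) : ℕ) : ℝ) = N / (M + 1) := by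
    rw [hN]; push_cast; field_simp
  rw [hn]
  have hM0 : (0 : ℝ) < (M : ℝ) + 1 := by positivity
  have hmain : N / (M + 1) * (θ * e - θ ^ 2 * v) = 3 * Q * l ^ 2 / (M + 1) := by
    have : θ * e - θ ^ 2 * v = 3 * e ^ 2 / (16 * v) := by rw [hθ]; field_simp; ring
    rw [this, he2]; field_simp
  have hbias : N / (M + 1) * (4 * (θ * (2 * b)) / 2 ^ M) ≤ 1 / 4 := by
    have h1 : N / (M + 1) ≤ 2 ^ M := by
      refine le_trans (div_le_self hN0.le ?_) h2M
      linarith [(Nat.cast_nonneg M : (0 : ℝ) ≤ M)]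
    calc N / (M + 1) * (4 * (θ * (2 * b)) / 2 ^ M)
        ≤ 2 ^ M * (4 * (θ * (2 * b)) / 2 ^ M) := mul_le_mul_of_nonneg_right h1 (by positivity)
      _ = 8 * (θ * b) := by field_simp; ring
      _ ≤ 1 / 4 := by linarith
  -- Uses M + 1 ≤ 2l + 2 and l ≥ 10. The surplus of 5Q over 4Q, at least 1, absorbs the boundary
  -- term 1/16 and the bias 1/4.
  have hdecay : 5 * Q ≤ 3 * Q * l ^ 2 / (M + 1) := by
    rw [le_div_iff₀ hM0]
    have : 5 * ((M : ℝ) + 1) ≤ 3 * l ^ 2 := by nlinarith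
    nlinarith
  have hexpand : N / (M + 1) * (θ ^ 2 * v + 4 * (θ * (2 * b)) / 2 ^ M - θ * e)
      = N / (M + 1) * (4 * (θ * (2 * b)) / 2 ^ M) - N / (M + 1) * (θ * e - θ ^ 2 * v) := by ring
  rw [hexpand, hmain]
  linarith

/-- Here 5ᵏ is the size of a product of nets and D the total dimension. As 5 ≤ e², it is at most
e^{4D}, which the D in the exponent cancels; the remaining e^{-4L} is at most e^{-L} = δ/(2t). -/
lemma five_pow_mul_exp_le {k D : ℕ} (hk : k ≤ 2 * D) {L δ t : ℝ} (hδ : 0 < δ) (hδ1 : δ < 1)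
    (ht : 1 ≤ t) (hL : L = Real.log (2 * t / δ)) :
    (5 : ℝ) ^ k * Real.exp (-(4 * (L + D))) ≤ δ / 2 := by
  have h5 : (5 : ℝ) ≤ Real.exp 2 := by
    have := Real.exp_one_gt_d9
    rw [show (2 : ℝ) = 1 + 1 by norm_num, Real.exp_add]
    nlinarith
  have h1 : (5 : ℝ) ^ k ≤ Real.exp (4 * D) := by
    calc (5 : ℝ) ^ k ≤ 5 ^ (2 * D) := pow_le_pow_right₀ (by norm_num) hk
      _ ≤ Real.exp 2 ^ (2 * D) := pow_le_pow_left₀ (by norm_num) h5 _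
      _ = Real.exp (4 * D) := by rw [← Real.exp_nat_mul]; push_cast; ring_nf
  have hpos : 0 < 2 * t / δ := by positivity
  have h2δ : 2 / δ ≤ 2 * t / δ := div_le_div_of_nonneg_right (by linarith) hδ.le
  have hL0 : 0 ≤ L := by
    rw [hL]
    refine Real.log_nonneg (le_trans ?_ h2δ)
    rw [le_div_iff₀ hδ]; linarith
  calc (5 : ℝ) ^ k * Real.exp (-(4 * (L + D)))
      ≤ Real.exp (4 * D) * Real.exp (-(4 * (L + D))) :=
        mul_le_mul_of_nonneg_right h1 (Real.exp_pos _).le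
    _ = Real.exp (-(4 * L)) := by rw [← Real.exp_add]; ring_nf
    _ ≤ Real.exp (-L) := Real.exp_le_exp.2 (by linarith)
    _ = (2 * t / δ)⁻¹ := by rw [Real.exp_neg, hL, Real.exp_log hpos]
    _ ≤ (2 / δ)⁻¹ := inv_anti₀ (by positivity) h2δ
    _ = δ / 2 := by rw [inv_div]

/-- The sum of the two error terms is dominated by the stated rate. -/
lemma error_terms_le {σ κ lam mu Q R : ℝ} (hσ : 0 ≤ σ) (hκ : 0 ≤ κ) (hlam : 0 ≤ lam) (hmu : 0 ≤ mu)
    (hQ : 0 ≤ Q) (hR : 0 ≤ R) :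
    2 * (8 * (4 * Real.sqrt (κ * lam * Q * R⁻¹))) * (2 * σ) +
        Real.sqrt lam * (2 * σ ^ 2 * (4 * (4 * Real.sqrt (mu * Q * R⁻¹))))
      ≤ 256 * σ * Real.sqrt (lam * Q * (κ + mu * σ ^ 2) / R) := by
  have hRi : 0 ≤ R⁻¹ := inv_nonneg.2 hR
  set X := Real.sqrt (lam * Q * (κ + mu * σ ^ 2) / R) with hX
  have h1 : Real.sqrt (κ * lam * Q * R⁻¹) ≤ X := by
    refine Real.sqrt_le_sqrt ?_
    rw [div_eq_mul_inv]
    refine mul_le_mul_of_nonneg_right ?_ hRi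
    have : 0 ≤ lam * Q * (mu * σ ^ 2) := by positivity
    nlinarith
  have h2 : Real.sqrt lam * (σ * Real.sqrt (mu * Q * R⁻¹)) ≤ X := by
    rw [← Real.sqrt_sq hσ, ← Real.sqrt_mul (by positivity), ← Real.sqrt_mul hlam]
    refine Real.sqrt_le_sqrt ?_
    rw [div_eq_mul_inv]
    have : lam * (σ ^ 2 * (mu * Q * R⁻¹)) = lam * Q * (mu * σ ^ 2) * R⁻¹ := by ring
    rw [this]
    refine mul_le_mul_of_nonneg_right ?_ hRi
    have : 0 ≤ lam * Q * κ := by positivity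
    nlinarith
  have hX0 : 0 ≤ X := Real.sqrt_nonneg _
  -- The two terms carry the coefficients 128 and 32, whose sum is below 256.
  have e1 := mul_le_mul_of_nonneg_left h1 hσ
  have e2 := mul_le_mul_of_nonneg_left h2 hσ
  have e3 := mul_nonneg hσ hX0
  nlinarith

end Parameters

/-! ### Simultaneous deviations over a finite family -/

section UnionBound

variable {S A : Type*} [MeasurableSpace S] [MeasurableSpace A] {p : Kernel (S × A) S}
  [IsMarkovKernel p] {π : Kernel S A} [IsMarkovKernel π]
  {Ω : Type*} [MeasurableSpace Ω] {μ : Measure Ω} [IsProbabilityMeasure μ] {n : ℕ}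
  {s : Fin (n + 1) → Ω → S} {a : Fin n → Ω → A}

/-- With high probability, finitely many empirical means along a trajectory deviate little from
their stationary values. -/
lemma TensorMDP.IsTrajectory.exists_good_event (hd : IsTrajectory μ p π s a) {T : ℕ} (hT1 : 1 ≤ T)
    (hT : MixesBy (stateKernel p π) T) {ξ : Measure S} [IsProbabilityMeasure ξ]
    (hξ : Kernel.Invariant (stateKernel p π) ξ) {N : ℝ} (hN : N = (n : ℝ) / T) (hN2 : 2 ≤ N)
    (hlog : 10 ≤ Real.log N) {v b Q Q' : ℝ} (hv : 0 < v) (hb : 0 ≤ b) (hQ : 1 ≤ Q) (hQQ' : Q ≤ Q')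
    (h : 1024 * (b ^ 2 / v) * Q' ≤ N / Real.log N ^ 2) {ι : Type*} (I : Finset ι) {k : ℕ}
    (hI : I.card ≤ 5 ^ k) {y : ι → (S × A) × S → ℝ} (hy : ∀ i ∈ I, Measurable (y i))
    (hyb : ∀ i ∈ I, ∀ z, |y i z| ≤ b)
    (hvar : ∀ i ∈ I, ∫ z, y i z ^ 2 ∂(ξ.bind (stepKernel p π)) ≤ v) :
    ∃ B : Set Ω, MeasurableSet B ∧ μ.real B ≤ 5 ^ k * Real.exp (-(4 * Q)) ∧ ∀ ω ∉ B, ∀ i ∈ I,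
      (n : ℝ)⁻¹ * (∑ x : Fin n, y i ((s x.castSucc ω, a x ω), s x.succ ω))
        - ∫ z, y i z ∂(ξ.bind (stepKernel p π))
        ≤ 4 * Real.sqrt (v * Q * (Real.log N ^ 2 / N)) := by
  -- The choice depends only on the common bounds `v` and `b`, so it serves all members of the
  -- family.
  obtain ⟨θ, M, hθ0, hθb, hexp⟩ := bernstein_exponent_le hT1 hN hN2 hlog hv hb hQ hQQ' h
  set ε := 4 * Real.sqrt (v * Q * (Real.log N ^ 2 / N)) with hε
  have hn : 0 < n := by
    rcases Nat.eq_zero_or_pos n with h0 | h0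
    · rw [hN, h0] at hN2; norm_num at hN2
    · exact h0
  let bad : ι → Set Ω := fun i =>
    {ω | ε ≤ (n : ℝ)⁻¹ * (∑ x : Fin n, y i ((s x.castSucc ω, a x ω), s x.succ ω))
      - ∫ z, y i z ∂(ξ.bind (stepKernel p π))}
  refine ⟨⋃ i ∈ I, bad i, Finset.measurableSet_biUnion _ fun i hi => ?_, ?_, fun ω hω i hi => ?_⟩
  · refine measurableSet_le measurable_const (Measurable.sub_const (Measurable.const_mul ?_ _) _)
    exact Finset.measurable_fun_sum _ fun x _ => (hy i hi).comp
      (((hd.measurable_state _).prodMk (hd.measurable_action _)).prodMk (hd.measurable_state _))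
  · refine (measureReal_biUnion_finset_le I bad).trans ?_
    calc ∑ i ∈ I, μ.real (bad i) ≤ ∑ _i ∈ I, Real.exp (-(4 * Q)) :=
          Finset.sum_le_sum fun i hi =>
            (hd.measure_le_sum_transition_le hT1 hT hξ (hy i hi) hb (hyb i hi) (hvar i hi) hθ0 hθb
              hn M).trans (Real.exp_le_exp.2 hexp)
      _ = I.card * Real.exp (-(4 * Q)) := by rw [Finset.sum_const, nsmul_eq_mul]
      _ ≤ 5 ^ k * Real.exp (-(4 * Q)) :=
          mul_le_mul_of_nonneg_right (by exact_mod_cast hI) (Real.exp_pos _).le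
  · simp only [Set.mem_iUnion, not_exists] at hω
    exact (not_le.1 (hω i hi)).le

end UnionBound

/-! ### Assembly of the main theorem -/

theorem theorem1
    {S A : Type*} [MeasurableSpace S] [MeasurableSpace A]
    -- the kernel spaces of functions of states and of actions, and their features
    {HS : Type*} [NormedAddCommGroup HS] [InnerProductSpace ℝ HS] [CompleteSpace HS]
    [RKHS ℝ HS S ℝ]
    {HA : Type*} [NormedAddCommGroup HA] [InnerProductSpace ℝ HA] [CompleteSpace HA]
    [RKHS ℝ HA A ℝ]
    {dS dA : ℕ} (φ : Fin dS → HS) (ψ : Fin dA → HA)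
    (hφ : IsFeatureMap (X := S) φ) (hψ : IsFeatureMap (X := A) ψ)
    (hφm : ∀ i, Measurable fun s => φ i s) (hψm : ∀ j, Measurable fun a => ψ j a)
    -- the transition law, of low Tucker rank
    (p : Kernel (S × A) S) [IsMarkovKernel p]
    (r l m : ℕ) (hp : LowRankTransition HS HA p r l m)
    -- the behavior policy and the measure `η`, with densities with respect to `refA`
    (refA : Measure A)
    (πbar : Kernel S A) [IsMarkovKernel πbar]
    (dens : S → A → ℝ≥0) (hdens : Measurable (Function.uncurry dens))
    (hπbar : ∀ s, πbar s = refA.withDensity fun a => (dens s a : ℝ≥0∞))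
    (η : Measure A) [IsProbabilityMeasure η]
    (eta : A → ℝ≥0) (heta : Measurable eta)
    (hη : η = refA.withDensity fun a => (eta a : ℝ≥0∞))
    (hψη : OrthonormalL2 ψ η)
    -- the stationary state distribution under the behavior policy
    (ξ : Measure S) [IsProbabilityMeasure ξ]
    (hξ : Kernel.Invariant (stateKernel p πbar) ξ)
    -- the parameters of the problem are finite, and the divisors are nonzero
    (ht : worstMixingTime p ≠ ⊤)
    (hκ : kappa eta dens ≠ ⊤)
    (hKS : BddAbove (Set.range fun s : S => scalarKernel HS s s))
    (hKA : BddAbove (Set.range fun a : A => scalarKernel HA a a))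
    (hcov : IsUnit (covMatrix φ ξ).det)
    (hlam : 0 < lambdaBar p φ ψ ξ η)
    -- the data: a single trajectory under the behavior policy
    {Ω : Type*} [MeasurableSpace Ω] (μ : Measure Ω) [IsProbabilityMeasure μ]
    {n : ℕ} (s : Fin (n + 1) → Ω → S) (a : Fin n → Ω → A)
    (hdata : IsTrajectory μ p πbar s a)
    (δ : ℝ) (hδ0 : 0 < δ) (hδ1 : δ < 1)
    -- abbreviations for the parameters
    (t N σ κ lam mu K : ℝ)
    (ht_def : t = ((worstMixingTime p).toNat : ℝ))
    (hN_def : N = (n : ℝ) / t)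
    (hσ_def : σ = matNorm (covMatrix φ ξ)⁻¹)
    (hκ_def : κ = (kappa eta dens).toReal)
    (hlam_def : lam = lambdaBar p φ ψ ξ η)
    (hmu_def : mu = muBar φ ξ)
    (hK_def : K = kMax S A HS HA)
    -- the sample size condition
    (hN2 : 2 ≤ N)
    (hn : 1024 * (σ ^ 2 * mu + K ^ 2 / mu + κ * K ^ 3 / lam) *
        (Real.log (2 * t / δ) + 8 * ((dS : ℝ) + (dA : ℝ))) ≤ N / (Real.log N) ^ 2) :
    ∃ P : Tensor3 dS dA dS,
      -- `P` is the transition tensor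
      IsTransitionTensor p φ ψ P ∧ TuckerRankLE P r l m ∧
      (∀ P' : Tensor3 dS dA dS, IsTransitionTensor p φ ψ P' → P' = P) ∧
      -- the error bound holds with probability at least `1 - δ`
      ∃ E : Set Ω, MeasurableSet E ∧ 1 - δ ≤ μ.real E ∧
        ∀ ω ∈ E, IsUnit (empCov φ fun i => s i ω).det ∧
          ∀ Fhat : Tensor3 dS dA dS,
            IsBestTuckerApprox r l m
              (meanEmbedding φ ψ eta dens (fun i => s i ω) (fun i => a i ω)) Fhat →
            tensorNorm (modeOne Fhat (empCov φ fun i => s i ω)⁻¹ - P) ≤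
              256 * σ * Real.sqrt
                (lam * (Real.log (2 * t / δ) + (dS : ℝ) + (dA : ℝ)) * (κ + mu * σ ^ 2) /
                  (N / (Real.log N) ^ 2)) := by
  subst hσ_def hκ_def hlam_def hmu_def hK_def
  set σ := matNorm (covMatrix φ ξ)⁻¹ with hσ
  set κ := (kappa eta dens).toReal with hκ'
  set lam := lambdaBar p φ ψ ξ η with hlam'
  set mu := muBar φ ξ with hmu
  set K := kMax S A HS HA with hK
  have hKSle : ∀ s : S, scalarKernel HS s s ≤ K := fun s => (le_ciSup hKS s).trans (le_max_left _ _)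
  have hKAle : ∀ a : A, scalarKernel HA a a ≤ K := fun a => (le_ciSup hKA a).trans (le_max_right _ _)
  have hSne : Nonempty S := nonempty_of_isProbabilityMeasure ξ
  have hK0 : 0 ≤ K := (hφ.kernel_nonneg hSne.some).trans (hKSle _)
  obtain ⟨P, hP, hPrank⟩ := exists_transitionTensor hφ hψ hp
  refine ⟨P, hP, hPrank, fun P' hP' =>
    transitionTensor_unique hφ hψ hφm hψm hKSle hKAle hcov hψη hP hP', ?_⟩
  -- In dimension zero there are no unit vectors, and λ̄ would be the supremum of the empty set,
  -- which is 0.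
  have hdS : NeZero dS := ⟨by
    rintro rfl
    refine hlam.ne' ?_
    have : {x : ℝ | ∃ (u : EuclideanSpace ℝ (Fin 0)) (v : EuclideanSpace ℝ (Fin dA))
        (w : EuclideanSpace ℝ (Fin 0)), ‖u‖ = 1 ∧ ‖v‖ = 1 ∧ ‖w‖ = 1 ∧
        x = ∫ z : (S × A) × S,
          ((∑ i, u i * φ i z.1.1) * (∑ j, v j * ψ j z.1.2) * (∑ k, w k * φ k z.2)) ^ 2
            ∂((ξ.prod η) ⊗ₘ p)} = ∅ := by
      refine Set.eq_empty_of_forall_notMem ?_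
      rintro _ ⟨u, -, -, hu, -⟩
      rw [Subsingleton.elim u 0, norm_zero] at hu
      exact zero_ne_one hu
    rw [hlam', lambdaBar, this, Real.sSup_empty]⟩
  obtain ⟨hT1, hT⟩ := mixesBy_of_worstMixingTime p ht πbar
  set T := (worstMixingTime p).toNat with hTdef
  have ht1 : 1 ≤ t := by rw [ht_def]; exact_mod_cast hT1
  have hNT : N = (n : ℝ) / T := by rw [hN_def, ht_def]
  set L := Real.log (2 * t / δ) with hL
  have hL0 : 0 ≤ L := Real.log_nonneg (by rw [le_div_iff₀ hδ0]; linarith)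
  have hD1 : (1 : ℝ) ≤ (dS : ℝ) + dA := by
    have h1 : (1 : ℝ) ≤ dS := by exact_mod_cast Nat.one_le_iff_ne_zero.2 hdS.out
    linarith [(Nat.cast_nonneg dA : (0 : ℝ) ≤ dA)]
  have hσ0 : 0 ≤ σ := matNorm_nonneg _
  have hmu0 : 0 ≤ mu := matNorm_nonneg _
  have hσmu : 1 ≤ σ ^ 2 * mu := one_le_sq_matNorm_inv_mul_muBar hφ hφm hKSle hcov
  have hmupos : 0 < mu := hmu0.lt_of_ne fun h => by rw [← h, mul_zero] at hσmu; linarith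
  have hκpos : 0 < κ := kappa_toReal_pos hη hκ
  set Q := L + ((dS : ℝ) + dA) with hQ
  set Q' := L + 8 * ((dS : ℝ) + dA) with hQ'
  have hQ1 : 1 ≤ Q := by linarith
  have hQQ' : Q ≤ Q' := by linarith
  have hQ8 : 8 ≤ Q' := by linarith
  set R := N / Real.log N ^ 2 with hR
  have hterms : 0 ≤ K ^ 2 / mu ∧ 0 ≤ κ * K ^ 3 / lam := by constructor <;> positivity
  have hcond : ∀ x, x ≤ σ ^ 2 * mu + K ^ 2 / mu + κ * K ^ 3 / lam → 1024 * x * Q' ≤ R :=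
    fun x hx => le_trans
      (mul_le_mul_of_nonneg_right (mul_le_mul_of_nonneg_left hx (by norm_num)) (by linarith)) hn
  have hcond_cov : 1024 * (σ ^ 2 * mu) * Q' ≤ R := hcond _ (by linarith)
  -- 1024 · 8, from σ²μ̄ ≥ 1 and `Q' ≥ 8`.
  have hR8 : 8192 ≤ R := by nlinarith
  have hlog : 10 ≤ Real.log N := ten_le_log hN2 hR8
  have hRinv : Real.log N ^ 2 / N = R⁻¹ := (inv_div _ _).symm
  have hR0 : 0 < R := by linarith
  obtain ⟨NS, hNScard, hNSnorm, hNS⟩ := exists_half_net dS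
  obtain ⟨NA, hNAcard, hNAnorm, hNA⟩ := exists_half_net dA
  -- Covariance event: v = μ̄ and b = K, so b²/v is the second term of the sample size condition.
  obtain ⟨B₁, hB₁m, hB₁, hgood₁⟩ := hdata.exists_good_event hT1 hT hξ hNT hN2 hlog hmupos hK0 hQ1
    hQQ' (hcond _ (by linarith)) (NS ×ˢ NS) (k := 2 * dS)
    (by
      rw [Finset.card_product, two_mul, pow_add]
      exact Nat.mul_le_mul hNScard hNScard)
    (y := fun i z => featureForm φ i.1 z.1.1 * featureForm φ i.2 z.1.1)
    (fun i _ => ((measurable_featureForm hφm i.1).mul (measurable_featureForm hφm i.2)).comp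
      (measurable_fst.comp measurable_fst))
    (fun i hi z => hφ.abs_featureForm_mul_le hKSle (hNSnorm _ (Finset.mem_product.1 hi).1)
      (hNSnorm _ (Finset.mem_product.1 hi).2) _)
    (fun i hi => by
      rw [integral_bind_stepKernel_fst
        (f := fun s => (featureForm φ i.1 s * featureForm φ i.2 s) ^ 2)
        (((measurable_featureForm hφm i.1).mul (measurable_featureForm hφm i.2)).pow_const 2)]
      exact integral_featureForm_sq_le_muBar hφ hφm hKSle (hNSnorm _ (Finset.mem_product.1 hi).1)
        (hNSnorm _ (Finset.mem_product.1 hi).2))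
  -- Embedding event: v = κλ̄ and b = κK^{3/2}, so b²/v is the third term of the condition.
  have hsq3 : (κ * Real.sqrt K ^ 3) ^ 2 / (κ * lam) = κ * K ^ 3 / lam := by
    have : (Real.sqrt K ^ 3) ^ 2 = K ^ 3 := by rw [← pow_mul, mul_comm, pow_mul, Real.sq_sqrt hK0]
    rw [mul_pow, this]
    field_simp
  obtain ⟨B₂, hB₂m, hB₂, hgood₂⟩ := hdata.exists_good_event hT1 hT hξ hNT hN2 hlog
    (mul_pos hκpos hlam) (b := κ * Real.sqrt K ^ 3) (by positivity) hQ1 hQQ'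
    (by rw [hsq3]; exact hcond _ (by linarith [sq_nonneg σ])) (NS ×ˢ NA ×ˢ NS)
    (k := dS + (dA + dS))
    (by
      rw [Finset.card_product, Finset.card_product, pow_add, pow_add]
      exact Nat.mul_le_mul hNScard (Nat.mul_le_mul hNAcard hNScard))
    (y := fun i z => (importanceWeight eta dens z : ℝ) * tripleForm φ ψ i.1 i.2.1 i.2.2 z)
    (fun i _ => ((measurable_importanceWeight hdens heta).coe_nnreal_real).mul
      (measurable_tripleForm hφm hψm _ _ _))
    (fun i hi z => by
      obtain ⟨h1, h2, h3⟩ := by simpa only [Finset.mem_product] using hi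
      rw [abs_mul, abs_of_nonneg (NNReal.coe_nonneg _)]
      exact mul_le_mul (importanceWeight_le hκ z) (abs_tripleForm_le hφ hψ hKSle hKAle
        (hNSnorm _ h1) (hNAnorm _ h2) (hNSnorm _ h3) z) (abs_nonneg _) hκpos.le)
    (fun i hi => by
      obtain ⟨h1, h2, h3⟩ := by simpa only [Finset.mem_product] using hi
      exact integral_importanceWeight_mul_sq_le hφ hψ hφm hψm hKSle hKAle hdens hπbar heta hη hκ
        (hNSnorm _ h1) (hNAnorm _ h2) (hNSnorm _ h3))
  rw [hRinv] at hgood₁ hgood₂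
  refine ⟨(B₁ ∪ B₂)ᶜ, (hB₁m.union hB₂m).compl, ?_, fun ω hω => ?_⟩
  · have hQcast : Q = L + ((dS + dA : ℕ) : ℝ) := by push_cast; rfl
    rw [hQcast] at hB₁ hB₂
    have h1 := hB₁.trans (five_pow_mul_exp_le (by omega) hδ0 hδ1 ht1 hL)
    have h2 := hB₂.trans (five_pow_mul_exp_le (by omega) hδ0 hδ1 ht1 hL)
    rw [probReal_compl_eq_one_sub (hB₁m.union hB₂m)]
    linarith [measureReal_union_le (μ := μ) B₁ B₂]
  rw [Set.mem_compl_iff, Set.mem_union, not_or] at hω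
  set e₁ := 4 * Real.sqrt (mu * Q * R⁻¹) with he₁
  set e₂ := 4 * Real.sqrt (κ * lam * Q * R⁻¹) with he₂
  have hcovdev : matNorm ((empCov φ fun i => s i ω) - covMatrix φ ξ) ≤ 4 * e₁ := by
    refine matNorm_le_of_net hNS (by positivity) fun u hu v hv => ?_
    have h := hgood₁ ω hω.1 (u, v) (Finset.mem_product.2 ⟨hu, hv⟩)
    rw [integral_bind_stepKernel_fst (f := fun s => featureForm φ u s * featureForm φ v s)
      ((measurable_featureForm hφm u).mul (measurable_featureForm hφm v)),
      ← bilin_covMatrix hφ hφm hKSle] at h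
    have hsub : bilin ((empCov φ fun i => s i ω) - covMatrix φ ξ) u v
        = bilin (empCov φ fun i => s i ω) u v - bilin (covMatrix φ ξ) u v := by
      simp only [bilin, Matrix.sub_apply, sub_mul, Finset.sum_sub_distrib]
    rw [hsub, bilin_empCov]
    exact h
  have htensdev : ∀ u v w, trilin (meanEmbedding φ ψ eta dens (fun i => s i ω) (fun i => a i ω)
      - modeOne P (covMatrix φ ξ)) u v w ≤ 8 * e₂ * (‖u‖ * ‖v‖ * ‖w‖) := by
    refine trilin_le_of_net hNS hNA hNS (by positivity) fun u hu v hv w hw => ?_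
    have h := hgood₂ ω hω.2 (u, v, w)
      (Finset.mem_product.2 ⟨hu, Finset.mem_product.2 ⟨hv, hw⟩⟩)
    rw [integral_importanceWeight_mul hdens hπbar heta hη hκ,
      ← trilin_modeOne_covMatrix hφ hψ hφm hψm hKSle hKAle hψη hP] at h
    rw [trilin_sub, trilin_meanEmbedding]
    exact h
  -- This is what the first term σ²μ̄ of the sample size condition is for: the square is 256 σ²μ̄ Q
  -- / R ≤ 1/4.
  have hsmall : σ * (4 * e₁) ≤ 1 / 2 := by
    refine le_of_sq_le_sq ?_ (by norm_num)
    have h1 : (σ * (4 * e₁)) ^ 2 = 256 * (σ ^ 2 * mu) * Q * R⁻¹ := by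
      rw [he₁, mul_pow, mul_pow, mul_pow, Real.sq_sqrt (by positivity)]; ring
    have h2 : 256 * (σ ^ 2 * mu) * Q ≤ R / 4 := by
      have : σ ^ 2 * mu * Q ≤ σ ^ 2 * mu * Q' := mul_le_mul_of_nonneg_left hQQ' (by positivity)
      linarith
    rw [h1]
    calc 256 * (σ ^ 2 * mu) * Q * R⁻¹ ≤ R / 4 * R⁻¹ :=
          mul_le_mul_of_nonneg_right h2 (by positivity)
      _ = (1 / 2) ^ 2 := by field_simp; norm_num
  refine ⟨isUnit_det_of_matNorm_sub_le hcov hcovdev hsmall, fun Fhat hF => ?_⟩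
  refine (tensorNorm_plugin_sub_le hcov (c := 8 * e₂) (Λ := Real.sqrt lam) (by positivity)
    (Real.sqrt_nonneg _) hcovdev hsmall hF hPrank (fun u v w hu hv hw => ?_)
    (fun u v w hu hv hw => trilin_modeOne_covMatrix_le hφ hψ hφm hψm hKSle hKAle hψη hP hu hv hw)).trans ?_
  · have := htensdev u v w
    rwa [hu, hv, hw, mul_one, mul_one, mul_one] at this
  · rw [add_assoc L]
    exact error_terms_le hσ0 hκpos.le hlam.le hmu0 (by linarith) hR0.le
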